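/- Let $M$ be a connected smooth $4$-manifold without boundary (Hausdorff and second countable, not necessarily compact), let $x\in M$, and suppose that $\pi_1(M,x)$ is residually finite. Then for every $\alpha\in\pi_2(M,x)$ there are a connected smooth $4$-manifold $M'$ (Hausdorff, second countable, without boundary), a smooth finite-sheeted covering map $p':M'\to M$ and a smooth immersion $h':S^2\to M'$ with $p'(h'(s_0))=x$, where $s_0$ is the base point (north pole) of $S^2$, such that $p'_*([h'])=\alpha$ in $\pi_2(M,x)$, where $[h']\in\pi_2(M',h'(s_0))$ is the class of $h'$, and such that for every $z\in h'(S^2)$ the homomorphism $\pi_1(h'(S^2),z)\to\pi_1(M',z)$ induced by the inclusion $h'(S^2)\subset M'$ is trivial. -/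

import Mathlib

open scoped Manifold ContDiff Topology unitInterval

universe u

noncomputable section

/-- The standard 2-sphere, the unit sphere of Euclidean 3-space. -/
abbrev Sphere2 : Type := Metric.sphere (0 : EuclideanSpace ℝ (Fin 3)) 1

/-- The rescaled coordinate `2 s - 1 ∈ [-1, 1]` of `s ∈ [0, 1]`. -/
def collapseCoord (t : Fin 2 → I) (i : Fin 2) : ℝ := 2 * (t i : ℝ) - 1

/-- `w = (1 - u²) (1 - v²)`, where `u`, `v` are the rescaled coordinates; it is positive in the
interior of the square and zero on its boundary. -/
def collapseWeight (t : Fin 2 → I) : ℝ :=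
  (1 - collapseCoord t 0 ^ 2) * (1 - collapseCoord t 1 ^ 2)

def collapseDenom (t : Fin 2 → I) : ℝ :=
  collapseCoord t 0 ^ 2 + collapseCoord t 1 ^ 2 + collapseWeight t ^ 2

theorem collapseDenom_pos (t : Fin 2 → I) : 0 < collapseDenom t := by
  unfold collapseDenom collapseWeight
  generalize collapseCoord t 0 = a
  generalize collapseCoord t 1 = b
  by_cases ha : a = 0
  · by_cases hb : b = 0
    · subst ha hb; norm_num
    · positivity
  · positivity

/-- The inverse stereographic projection of the point `(u / w, v / w)` of the plane, with
denominators cleared. -/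
def collapseVec (t : Fin 2 → I) : EuclideanSpace ℝ (Fin 3) :=
  !₂[2 * collapseCoord t 0 * collapseWeight t / collapseDenom t,
    2 * collapseCoord t 1 * collapseWeight t / collapseDenom t,
    (collapseCoord t 0 ^ 2 + collapseCoord t 1 ^ 2 - collapseWeight t ^ 2) / collapseDenom t]

theorem collapseVec_mem (t : Fin 2 → I) :
    collapseVec t ∈ Metric.sphere (0 : EuclideanSpace ℝ (Fin 3)) 1 := by
  have h := (collapseDenom_pos t).ne'
  rw [mem_sphere_zero_iff_norm, EuclideanSpace.norm_eq, Real.sqrt_eq_one]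
  simp only [collapseVec, Fin.sum_univ_three, Real.norm_eq_abs, sq_abs]
  simp only [Matrix.cons_val_zero, Matrix.cons_val_one, Matrix.cons_val]
  field_simp
  unfold collapseDenom
  ring

theorem continuous_collapseVec : Continuous collapseVec := by
  have hc : ∀ i, Continuous fun t : Fin 2 → I => collapseCoord t i := fun i => by
    unfold collapseCoord; fun_prop
  have hw : Continuous collapseWeight := by
    unfold collapseWeight
    exact (continuous_const.sub ((hc 0).pow 2)).mul (continuous_const.sub ((hc 1).pow 2))
  have hd : Continuous collapseDenom := by
    unfold collapseDenom
    exact (((hc 0).pow 2).add ((hc 1).pow 2)).add (hw.pow 2)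
  have hn : ∀ t, collapseDenom t ≠ 0 := fun t => (collapseDenom_pos t).ne'
  unfold collapseVec
  refine (PiLp.continuous_toLp 2 _).comp (continuous_pi fun i => ?_)
  fin_cases i
  · exact ((continuous_const.mul (hc 0)).mul hw).div hd hn
  · exact ((continuous_const.mul (hc 1)).mul hw).div hd hn
  · exact ((((hc 0).pow 2).add ((hc 1).pow 2)).sub (hw.pow 2)).div hd hn

/-- The standard identification of the square modulo its boundary with the 2-sphere: the interior
of the square is mapped homeomorphically onto the complement of the north pole, the boundary to
the north pole. -/
def collapse : C(Fin 2 → I, Sphere2) :=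
  ⟨fun t => ⟨collapseVec t, collapseVec_mem t⟩, continuous_collapseVec.subtype_mk _⟩

/-- The base point of the 2-sphere. -/
def northPole : Sphere2 := ⟨!₂[0, 0, 1], by
  rw [mem_sphere_zero_iff_norm, EuclideanSpace.norm_eq, Real.sqrt_eq_one]
  simp [Fin.sum_univ_three]⟩

theorem collapse_boundary (t : Fin 2 → I) (ht : t ∈ Cube.boundary (Fin 2)) :
    collapse t = northPole := by
  have hw : collapseWeight t = 0 := by
    obtain ⟨i, hi⟩ := ht
    have hs : 1 - collapseCoord t i ^ 2 = 0 := by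
      rcases hi with h | h <;> (simp [collapseCoord, h]; try norm_num)
    fin_cases i
    · exact mul_eq_zero_of_left hs _
    · exact mul_eq_zero_of_right _ hs
  have hd := (collapseDenom_pos t).ne'
  have h1 : (collapseCoord t 0 ^ 2 + collapseCoord t 1 ^ 2 - collapseWeight t ^ 2)
      / collapseDenom t = 1 := by
    rw [div_eq_one_iff_eq hd, collapseDenom, hw]; ring
  apply Subtype.ext
  change collapseVec t = !₂[0, 0, 1]
  rw [collapseVec, h1, hw]
  simp

/-- The class `[f] ∈ π₂(X, f(north pole))` of a continuous map `f : S² → X`. -/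
def sphereClass {X : Type*} [TopologicalSpace X] (f : C(Sphere2, X)) :
    π_ 2 X (f northPole) :=
  Quotient.mk (GenLoop.Homotopic.setoid (Fin 2) (f northPole))
    ⟨f.comp collapse, fun t ht => congrArg f (collapse_boundary t ht)⟩

/-- The map `f_* : π_n(X, x) → π_n(Y, y)` induced by a continuous map `f` with `f x = y`. -/
def inducedPi {X Y : Type*} [TopologicalSpace X] [TopologicalSpace Y] {n : ℕ} (f : C(X, Y))
    {x : X} {y : Y} (hxy : f x = y) : π_ n X x → π_ n Y y :=
  Quotient.map
    (fun g => (⟨f.comp g.1, fun t ht => (congrArg f (g.2 t ht)).trans hxy⟩ :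
      GenLoop (Fin n) Y y))
    (fun _ _ H => ContinuousMap.HomotopicRel.comp_continuousMap H f)

/-- The inclusion of a subspace as a continuous map. -/
def inclusionMap {X : Type*} [TopologicalSpace X] (S : Set X) : C(S, X) :=
  ⟨Subtype.val, continuous_subtype_val⟩

end

/-! Represent $\alpha$ by a smooth immersion $h:S^2\to M$ and lift it to a map $F$ into the
universal covering. If $h(s)=h(t)$, then $F(s)$ and $F(t)$ lie in one fibre and differ by an element
of $\pi_1(M,x)$. These elements are locally constant on the compact set of pairs with $h(s)=h(t)$,
so only finitely many occur. Residual finiteness gives a finite quotient $Q$ of $\pi_1(M,x)$ in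
which none of the nontrivial ones dies.

Let $M'$ be the finite covering belonging to the kernel and $h'$ the image of $F$ in $M'$. By the
choice of $Q$, $h'(s)=h'(t)$ forces $F(s)=F(t)$, so $F$ descends to a map from $h'(S^2)$ to the
universal covering. The inclusion $h'(S^2)\subset M'$ therefore factors through a simply connected
space and is trivial on $\pi_1$. This is `exists_lift_fundamentalGroup_map_eq_one`.

Both coverings are instances of one construction, `FlatPaths.Cover`: the flat principal bundle with
discrete fibre and holonomy $\varphi$. A bijective $\varphi$ gives the universal covering, a
surjection onto a finite group gives $M'$.

The immersion comes from `exists_homotopicRel_contMDiff_injective_mfderiv`. A continuous map is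
first smoothed and then made immersive, chart by chart, by small homotopies fixing the base point.
The second stage rests on a dimension count: linear maps $\mathbb R^2\to\mathbb R^4$ of rank at most
1 depend on 5 parameters, and subtracting derivatives at points of a surface adds 2, which is still
less than $8=\dim\mathrm{Hom}(\mathbb R^2,\mathbb R^4)$. -/

noncomputable section

/-! ### Coverings of $M$ attached to homomorphisms from $\pi_1(M,x)$ -/

/-- An open cover of `M` by sets carrying, for each member, a choice of homotopy classes of paths
from `x` to its points that is compatible with paths inside that member. -/
structure FlatPaths {M : Type u} [TopologicalSpace M] (x : M) where
  U : M → Set M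
  isOpen_U : ∀ y, IsOpen (U y)
  mem_U : ∀ y, y ∈ U y
  c : ∀ _ m : M, Path.Homotopic.Quotient x m
  flat : ∀ (y : M) {m m' : M} (δ : Path m m'), (∀ t, δ t ∈ U y) →
    c y m' = (c y m).trans (Path.Homotopic.Quotient.mk δ)

theorem FlatPaths.nonempty {M : Type u} [TopologicalSpace M] [PathConnectedSpace M] (x : M)
    (hM : ∀ y : M, ∃ U : Set M, IsOpen U ∧ y ∈ U ∧ IsSimplyConnected U) :
    Nonempty (FlatPaths x) := by
  classical
  choose U hU hyU hsc using hM
  have (y : M) : SimplyConnectedSpace (U y) := (hsc y).simplyConnectedSpace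
  let ι (y : M) : C(U y, M) := ⟨Subtype.val, continuous_subtype_val⟩
  let b (y : M) : Path x y := PathConnectedSpace.somePath x y
  let d (y : M) (m : U y) : Path (⟨y, hyU y⟩ : U y) m := PathConnectedSpace.somePath _ _
  -- Go from `x` to `y`, then inside `U y` to `m`; simple connectedness of `U y` makes the class
  -- independent of the second path. Off `U y` the value is arbitrary, since `flat` only concerns
  -- paths in `U y`.
  refine ⟨⟨U, hU, hyU, fun y m => if h : m ∈ U y then
    (Path.Homotopic.Quotient.mk (b y)).trans ((Path.Homotopic.Quotient.mk (d y ⟨m, h⟩)).map (ι y))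
    else .mk (PathConnectedSpace.somePath x m), ?_⟩⟩
  intro y m m' δ hδ
  have hm : m ∈ U y := by simpa using hδ 0
  have hm' : m' ∈ U y := by simpa using hδ 1
  simp only [dif_pos hm, dif_pos hm', Path.Homotopic.Quotient.trans_assoc]
  congr 1
  let δ' : Path (⟨m, hm⟩ : U y) ⟨m', hm'⟩ :=
    ⟨⟨fun t => ⟨δ t, hδ t⟩, by fun_prop⟩, by simp, by simp⟩
  have h1 : (Path.Homotopic.Quotient.mk (d y ⟨m', hm'⟩)) =
      (Path.Homotopic.Quotient.mk ((d y ⟨m, hm⟩).trans δ')) := Subsingleton.elim _ _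
  rw [h1, ← Path.Homotopic.Quotient.mk_map, ← Path.Homotopic.Quotient.mk_map,
    ← Path.Homotopic.Quotient.mk_trans, Path.map_trans]
  rfl

namespace FlatPaths

variable {M : Type u} [TopologicalSpace M] {x : M} (S : FlatPaths x)

/-- The loop comparing the chosen path classes of two members of the cover. -/
def transition (i j m : M) : FundamentalGroup M x := (S.c i m).trans (S.c j m).symm

theorem transition_self (i m : M) : S.transition i i m = 1 := by
  simp only [transition, Path.Homotopic.Quotient.trans_symm]; rfl

theorem transition_mul (i j k m : M) :
    S.transition j k m * S.transition i j m = S.transition i k m := by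
  simp only [transition, FundamentalGroup.mul_def]
  rw [Path.Homotopic.Quotient.trans_assoc, ← Path.Homotopic.Quotient.trans_assoc (S.c j m).symm]
  simp

theorem trans_symm_c_eq (i : M) {m m' : M} (δ : Path m m')
    (hδ : ∀ t, δ t ∈ S.U i) (D : Path.Homotopic.Quotient x m) :
    (D.trans (.mk δ)).trans (S.c i m').symm = D.trans (S.c i m).symm := by
  have h : (Path.Homotopic.Quotient.mk δ).trans (S.c i m').symm = (S.c i m).symm := by
    have h2 : (S.c i m).trans ((Path.Homotopic.Quotient.mk δ).trans (S.c i m').symm) =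
        .refl x := by
      rw [← Path.Homotopic.Quotient.trans_assoc, ← S.flat i δ hδ]; simp
    calc _ = (S.c i m).symm.trans ((S.c i m).trans ((Path.Homotopic.Quotient.mk δ).trans
          (S.c i m').symm)) := by rw [← Path.Homotopic.Quotient.trans_assoc]; simp
      _ = _ := by rw [h2]; simp
  rw [Path.Homotopic.Quotient.trans_assoc, h]

theorem eventually_transition_eq [LocallyPathConnectedSpace M] (i j m : M) (hi : m ∈ S.U i)
    (hj : m ∈ S.U j) : ∀ᶠ m' in 𝓝 m, S.transition i j m' = S.transition i j m := by
  have hW : S.U i ∩ S.U j ∈ 𝓝 m :=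
    ((S.isOpen_U i).inter (S.isOpen_U j)).mem_nhds ⟨hi, hj⟩
  filter_upwards [pathComponentIn_mem_nhds hW] with m' hm'
  obtain ⟨δ, hδ⟩ := hm'
  unfold transition
  rw [S.flat i δ fun t => (hδ t).1]
  exact S.trans_symm_c_eq j δ (fun t => (hδ t).2) _

variable {Q : Type u} [Group Q] [TopologicalSpace Q] [DiscreteTopology Q]
  [LocallyPathConnectedSpace M] (φ : FundamentalGroup M x →* Q)

/-- The principal `Q`-bundle with holonomy `φ`. -/
def core : FiberBundleCore M M Q where
  baseSet := S.U
  isOpen_baseSet := S.isOpen_U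
  indexAt := id
  mem_baseSet_at := S.mem_U
  -- The product of `FundamentalGroup` is concatenation in reverse order, so left multiplication
  -- satisfies the cocycle rule. Right multiplication by `Q` thus commutes with all coordinate
  -- changes.
  coordChange i j m g := φ (S.transition i j m) * g
  coordChange_self i m _ g := by rw [transition_self, map_one, one_mul]
  continuousOn_coordChange i j := by
    rintro ⟨m, g⟩ ⟨⟨hi, hj⟩, -⟩
    apply ContinuousAt.continuousWithinAt
    apply continuousAt_const (y := φ (S.transition i j m) * g) |>.congr
    have h1 := continuous_fst.continuousAt (x := (m, g)) |>.eventually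
      (S.eventually_transition_eq i j m hi hj)
    have h2 : ∀ᶠ p : M × Q in 𝓝 (m, g), p.2 = g :=
      continuous_snd.continuousAt (x := (m, g)) |>.eventually
        ((isOpen_discrete {g}).mem_nhds rfl)
    filter_upwards [h1, h2] with p hp1 hp2
    rw [hp1, hp2]
  coordChange_comp i j k m _ g := by
    rw [← mul_assoc, ← map_mul, transition_mul]

/-- The covering space of `M` associated with `φ`. -/
abbrev Cover : Type u := Bundle.TotalSpace Q (S.core φ).Fiber

instance (m : M) : DiscreteTopology ((S.core φ).Fiber m) := inferInstanceAs (DiscreteTopology Q)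

/-- The covering map. -/
def proj : C(S.Cover φ, M) := ⟨Bundle.TotalSpace.proj, (S.core φ).continuous_proj⟩

theorem isCoveringMap_proj : IsCoveringMap (S.proj φ) :=
  FiberBundle.isCoveringMap (F := Q) (E := (S.core φ).Fiber)

/-- The coordinate of a point of the covering space in the preferred trivialization. -/
def coord (e : S.Cover φ) : Q := e.snd

variable {φ} in
theorem cover_ext {e e' : S.Cover φ} (h : S.proj φ e = S.proj φ e')
    (h' : S.coord φ e = S.coord φ e') : e = e' := by
  obtain ⟨m, g⟩ := e
  obtain ⟨m', g'⟩ := e'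
  obtain rfl : m = m' := h
  obtain rfl : g = g' := h'
  rfl

variable {φ} in
-- The fibre is discrete, so continuity in the fibre direction means that the coordinate, moved to
-- the trivialization at `f s`, is constant near `s`.
theorem continuousAt_cover_iff {X : Type*} [TopologicalSpace X] {f : X → S.Cover φ} {s : X} :
    ContinuousAt f s ↔ ContinuousAt (fun t => S.proj φ (f t)) s ∧
      ∀ᶠ t in 𝓝 s, φ (S.transition (S.proj φ (f t)) (S.proj φ (f s)) (S.proj φ (f t))) *
        S.coord φ (f t) = S.coord φ (f s) := by
  rw [FiberBundle.continuousAt_totalSpace]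
  refine and_congr_right fun _ => ?_
  change ContinuousAt (fun t => φ (S.transition (S.proj φ (f t)) (S.proj φ (f s))
    (S.proj φ (f t))) * S.coord φ (f t)) s ↔ _
  rw [ContinuousAt, nhds_discrete Q, Filter.tendsto_pure]
  simp only [transition_self, map_one, one_mul]

/-- The point of the covering space represented by a class of paths. -/
def pt {m : M} (C : Path.Homotopic.Quotient x m) : S.Cover φ :=
  ⟨m, φ (C.trans (S.c m m).symm : Path.Homotopic.Quotient x x)⟩

theorem coord_pt {m : M} (C : Path.Homotopic.Quotient x m) :
    S.coord φ (S.pt φ C) = φ (C.trans (S.c m m).symm : Path.Homotopic.Quotient x x) := rfl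

theorem proj_pt {m : M} (C : Path.Homotopic.Quotient x m) : S.proj φ (S.pt φ C) = m := rfl

variable {φ} in
theorem exists_pt_eq (hφ : Function.Surjective φ) (e : S.Cover φ) :
    ∃ C : Path.Homotopic.Quotient x (S.proj φ e), S.pt φ C = e := by
  obtain ⟨m, g⟩ := e
  obtain ⟨γ, rfl⟩ := hφ g
  refine ⟨Path.Homotopic.Quotient.trans γ (S.c m m), S.cover_ext rfl ?_⟩
  rw [coord_pt]
  change φ _ = φ γ
  congr 1
  change (Path.Homotopic.Quotient.trans γ (S.c m m)).trans (S.c m m).symm = _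
  rw [Path.Homotopic.Quotient.trans_assoc]
  simp

variable {φ} in
theorem pt_injective (hφ : Function.Injective φ) {m : M} :
    Function.Injective (S.pt φ (m := m)) := by
  intro C C' h
  have h1 : S.coord φ (S.pt φ C) = S.coord φ (S.pt φ C') := by rw [h]
  have h2 : C.trans (S.c m m).symm = C'.trans (S.c m m).symm := hφ h1
  have h3 := congrArg (fun D => Path.Homotopic.Quotient.trans D (S.c m m)) h2
  simpa [Path.Homotopic.Quotient.trans_assoc] using h3

theorem transition_mul_coord {m : M} (C : Path.Homotopic.Quotient x m) (i : M) :
    φ (S.transition m i m) * S.coord φ (S.pt φ C) =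
      φ (C.trans (S.c i m).symm : Path.Homotopic.Quotient x x) := by
  rw [coord_pt, ← map_mul, FundamentalGroup.mul_def, transition]
  congr 1
  rw [Path.Homotopic.Quotient.trans_assoc, ← Path.Homotopic.Quotient.trans_assoc (S.c m m).symm]
  simp

theorem pt_cast {m m' m'' : M} (C : Path.Homotopic.Quotient x m) (δ : Path m m') (h : m'' = m') :
    S.pt φ (C.trans (.mk (δ.cast rfl h))) = S.pt φ (C.trans (.mk δ)) := by
  subst h; rfl

/-- The lift of `δ` is explicit: at time `t` it is the point represented by `C` followed by `δ`
restricted to `[0, t]`. It is continuous because short pieces of `δ` stay in one member of the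
cover, where flatness keeps the coordinate constant. -/
theorem exists_path_pt {m m' : M} (C : Path.Homotopic.Quotient x m) (δ : Path m m') :
    ∃ Γ : Path (S.pt φ C) (S.pt φ (C.trans (.mk δ))), ∀ t, S.proj φ (Γ t) = δ t := by
  let D (t : I) : Path.Homotopic.Quotient x (δ t) :=
    C.trans (.mk ((δ.subpath 0 t).cast δ.source.symm rfl))
  have hD (s t : I) : D t = (D s).trans (.mk (δ.subpath s t)) := by
    simp only [D, Path.Homotopic.Quotient.trans_assoc]
    rw [← Path.Homotopic.Quotient.mk_trans]
    congr 1
    exact (Path.Homotopic.Quotient.eq.2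
      (Path.Homotopic.pathCast ⟨Path.Homotopy.subpathTransSubpath δ 0 s t⟩ δ.source.symm rfl)).symm
  have h0 : S.pt φ (D 0) = S.pt φ C := by
    have : (δ.subpath 0 0).cast δ.source.symm rfl = (Path.refl m).cast rfl δ.source := by
      ext; simp
    simp only [D, this]
    rw [pt_cast, Path.Homotopic.Quotient.mk_refl, Path.Homotopic.Quotient.trans_refl]
  have h1 : S.pt φ (D 1) = S.pt φ (C.trans (.mk δ)) := by
    have : (δ.subpath 0 1).cast δ.source.symm rfl = δ.cast rfl δ.target := by
      ext; simp
    simp only [D, this]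
    rw [pt_cast]
  refine ⟨⟨⟨fun t => S.pt φ (D t), continuous_iff_continuousAt.2 fun s =>
    S.continuousAt_cover_iff.2 ⟨δ.continuous.continuousAt, ?_⟩⟩, h0, h1⟩, fun t => rfl⟩
  have hs : δ ⁻¹' (S.U (δ s)) ∈ 𝓝 s :=
    ((S.isOpen_U _).preimage δ.continuous).mem_nhds (S.mem_U _)
  obtain ⟨ε, hε, hball⟩ := Metric.mem_nhds_iff.1 hs
  filter_upwards [Metric.ball_mem_nhds s hε] with t ht
  simp only [proj_pt]
  rw [transition_mul_coord, coord_pt, hD s t, S.trans_symm_c_eq]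
  intro u
  have hu : δ.subpath s t u ∈ δ '' Set.uIcc s t := by
    rw [← Path.range_subpath]; exact Set.mem_range_self u
  obtain ⟨v, hv, hvu⟩ := hu
  rw [← hvu]
  refine hball (Metric.mem_ball.2 (lt_of_le_of_lt ?_ ht))
  rw [Subtype.dist_eq, Subtype.dist_eq, Real.dist_eq, Real.dist_eq]
  refine Set.abs_sub_left_of_mem_uIcc ?_
  rcases Set.mem_uIcc.1 hv with h | h
  · exact Set.mem_uIcc.2 (Or.inl ⟨h.1, h.2⟩)
  · exact Set.mem_uIcc.2 (Or.inr ⟨h.1, h.2⟩)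

theorem pathConnectedSpace_cover [PathConnectedSpace M] (hφ : Function.Surjective φ) :
    PathConnectedSpace (S.Cover φ) := by
  let e₀ := S.pt φ (.refl x)
  have h (e : S.Cover φ) : Joined e₀ e := by
    obtain ⟨C, hC⟩ := S.exists_pt_eq hφ e
    rw [← hC]
    obtain ⟨δ, rfl⟩ := Path.Homotopic.Quotient.mk_surjective C
    obtain ⟨Γ, -⟩ := S.exists_path_pt φ (.refl x) δ
    exact ⟨by simpa using Γ⟩
  exact ⟨⟨e₀⟩, fun e e' => (h e).symm.trans (h e')⟩

/-- By unique lifting, a loop at `S.pt φ C` is the explicit lift of its projection, so its endpoint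
is represented by `C` followed by the projected loop. When `φ` is injective, points determine path
classes, so the projected loop is nullhomotopic; covering maps are injective on path classes. -/
theorem simplyConnectedSpace_cover [PathConnectedSpace M] (hφ : Function.Bijective φ) :
    SimplyConnectedSpace (S.Cover φ) := by
  have := S.pathConnectedSpace_cover φ hφ.2
  refine simply_connected_iff_loops_nullhomotopic.2 ⟨this, fun e γ => ?_⟩
  rw [← Path.Homotopic.Quotient.eq]
  have cov := S.isCoveringMap_proj φ
  apply cov.injective_path_homotopic_map e e
  obtain ⟨C, hC⟩ := S.exists_pt_eq hφ.2 e
  obtain ⟨Γ, hΓ⟩ := S.exists_path_pt φ C (γ.map (S.proj φ).continuous)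
  have hΓγ : (Γ : I → S.Cover φ) = γ :=
    cov.eq_of_comp_eq Γ.continuous γ.continuous (funext hΓ) 0 (by simp [hC])
  have hend : S.pt φ (C.trans (.mk (γ.map (S.proj φ).continuous))) = S.pt φ C := by
    rw [← Γ.target, hΓγ, γ.target, hC]
  have h := congrArg (C.symm.trans ·) (S.pt_injective hφ.1 hend)
  simp only [← Path.Homotopic.Quotient.trans_assoc, Path.Homotopic.Quotient.symm_trans,
    Path.Homotopic.Quotient.refl_trans] at h
  exact h

/-- The map of covering spaces induced by a homomorphism. -/
def coverMap {R : Type u} [Group R] [TopologicalSpace R] [DiscreteTopology R] (ψ : Q →* R) :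
    C(S.Cover φ, S.Cover (ψ.comp φ)) where
  toFun e := ⟨S.proj φ e, ψ (S.coord φ e)⟩
  continuous_toFun := by
    refine continuous_iff_continuousAt.2 fun e => S.continuousAt_cover_iff.2
      ⟨(S.proj φ).continuous.continuousAt, ?_⟩
    filter_upwards [((S.continuousAt_cover_iff (f := id) (s := e)).1
      continuousAt_id).2] with e' he'
    have := congrArg ψ he'
    rw [map_mul] at this
    exact this

end FlatPaths

/-! ### The sphere as the square modulo its boundary, and lifting of spheres -/

/-- The two points lie on one ray, and the one of larger weight has coordinates at least as large in
absolute value. But the weight decreases as these grow, so the weights agree. -/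
theorem eq_of_weight_mul_eq {u v u' v' : ℝ} (hu : u' ^ 2 ≤ 1)
    (hw : 0 < (1 - u ^ 2) * (1 - v ^ 2))
    (hle : (1 - u ^ 2) * (1 - v ^ 2) ≤ (1 - u' ^ 2) * (1 - v' ^ 2))
    (h₁ : u * ((1 - u' ^ 2) * (1 - v' ^ 2)) = u' * ((1 - u ^ 2) * (1 - v ^ 2)))
    (h₂ : v * ((1 - u' ^ 2) * (1 - v' ^ 2)) = v' * ((1 - u ^ 2) * (1 - v ^ 2))) :
    u = u' ∧ v = v' := by
  have key : (1 - u' ^ 2) * (1 - v' ^ 2) ≤ (1 - u ^ 2) * (1 - v ^ 2) := by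
    have aux : ∀ {a a' w w' : ℝ}, 0 < w → w ≤ w' → a * w' = a' * w → a ^ 2 ≤ a' ^ 2 := by
      intro a a' w w' hw hle h
      have h1 : a ^ 2 * w' ^ 2 = a' ^ 2 * w ^ 2 := by rw [← mul_pow, h, mul_pow]
      have h2 : a ^ 2 * w ^ 2 ≤ a ^ 2 * w' ^ 2 := by gcongr
      exact le_of_mul_le_mul_right (h2.trans_eq h1) (by positivity)
    have hu2 := aux hw hle h₁
    have hv2 := aux hw hle h₂
    exact mul_le_mul (by linarith) (by linarith) (by
      by_contra hneg
      push Not at hneg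
      nlinarith [mul_nonneg (sub_nonneg.2 hu) (neg_nonneg.2 hneg.le)]) (by linarith)
  have heq := le_antisymm hle key
  rw [← heq] at h₁ h₂
  exact ⟨mul_right_cancel₀ hw.ne' h₁, mul_right_cancel₀ hw.ne' h₂⟩

theorem collapseCoord_sq_le (t : Fin 2 → I) (i : Fin 2) : collapseCoord t i ^ 2 ≤ 1 := by
  have h0 := (t i).2.1
  have h1 := (t i).2.2
  unfold collapseCoord
  nlinarith

theorem collapseWeight_nonneg (t : Fin 2 → I) : 0 ≤ collapseWeight t :=
  mul_nonneg (by linarith [collapseCoord_sq_le t 0]) (by linarith [collapseCoord_sq_le t 1])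

theorem mem_boundary_of_collapseWeight_eq_zero {t : Fin 2 → I} (h : collapseWeight t = 0) :
    t ∈ Cube.boundary (Fin 2) := by
  have aux (i : Fin 2) (hi : 1 - collapseCoord t i ^ 2 = 0) : t i = 0 ∨ t i = 1 := by
    have : (t i : ℝ) * ((t i : ℝ) - 1) = 0 := by unfold collapseCoord at hi; linarith
    rcases mul_eq_zero.1 this with h | h
    · exact Or.inl (Subtype.ext h)
    · exact Or.inr (Subtype.ext (by simpa using sub_eq_zero.1 h))
  rcases mul_eq_zero.1 h with h | h
  · exact ⟨0, aux 0 h⟩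
  · exact ⟨1, aux 1 h⟩

theorem collapse_eq_iff {t t' : Fin 2 → I} (h : collapse t = collapse t') :
    t = t' ∨ t ∈ Cube.boundary (Fin 2) ∧ t' ∈ Cube.boundary (Fin 2) := by
  have hv : collapseVec t = collapseVec t' := congrArg Subtype.val h
  have e (i : Fin 3) : collapseVec t i = collapseVec t' i := by rw [hv]
  have e0 := e 0
  have e1 := e 1
  have e2 := e 2
  simp only [collapseVec, Matrix.cons_val_zero, Matrix.cons_val_one, Matrix.cons_val] at e0 e1 e2
  have hD := collapseDenom_pos t
  have hD' := collapseDenom_pos t'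
  have hw := collapseWeight_nonneg t
  have hw' := collapseWeight_nonneg t'
  have d : collapseDenom t =
    collapseCoord t 0 ^ 2 + collapseCoord t 1 ^ 2 + collapseWeight t ^ 2 := rfl
  have d' : collapseDenom t' =
    collapseCoord t' 0 ^ 2 + collapseCoord t' 1 ^ 2 + collapseWeight t' ^ 2 := rfl
  have hl : collapseWeight t = (1 - collapseCoord t 0 ^ 2) * (1 - collapseCoord t 1 ^ 2) := rfl
  have hl' : collapseWeight t' = (1 - collapseCoord t' 0 ^ 2) * (1 - collapseCoord t' 1 ^ 2) := rfl
  rw [div_eq_div_iff hD.ne' hD'.ne'] at e0 e1 e2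
  have e3 : collapseWeight t ^ 2 * collapseDenom t' = collapseWeight t' ^ 2 * collapseDenom t := by
    have h1 : collapseCoord t 0 ^ 2 + collapseCoord t 1 ^ 2 =
      collapseDenom t - collapseWeight t ^ 2 := by rw [d]; ring
    have h2 : collapseCoord t' 0 ^ 2 + collapseCoord t' 1 ^ 2 =
      collapseDenom t' - collapseWeight t' ^ 2 := by rw [d']; ring
    rw [h1, h2] at e2
    linarith
  by_cases hz : collapseWeight t = 0
  · right
    refine ⟨mem_boundary_of_collapseWeight_eq_zero hz, mem_boundary_of_collapseWeight_eq_zero ?_⟩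
    rw [hz] at e3
    have : collapseWeight t' ^ 2 = 0 := by
      by_contra hne
      have : collapseWeight t' ^ 2 * collapseDenom t = 0 := by linarith
      exact (mul_ne_zero hne hD.ne') this
    simpa using this
  left
  have hwp : 0 < collapseWeight t := lt_of_le_of_ne hw (Ne.symm hz)
  have hwp' : 0 < collapseWeight t' := by
    refine lt_of_le_of_ne hw' fun h0 => ?_
    rw [← h0] at e3
    have : collapseWeight t ^ 2 * collapseDenom t' = 0 := by linarith
    exact (mul_ne_zero (pow_ne_zero 2 hz) hD'.ne') this
  have aux (a a' : ℝ) (hE : 2 * a * collapseWeight t * collapseDenom t' =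
      2 * a' * collapseWeight t' * collapseDenom t) :
      a * collapseWeight t' = a' * collapseWeight t := by
    have h1 : (a * collapseWeight t') * (collapseWeight t * collapseDenom t') =
        (a' * collapseWeight t) * (collapseWeight t * collapseDenom t') := by
      calc _ = (2 * a * collapseWeight t * collapseDenom t') * collapseWeight t' / 2 := by ring
        _ = a' * (collapseWeight t' ^ 2 * collapseDenom t) := by rw [hE]; ring
        _ = _ := by rw [← e3]; ring
    exact mul_right_cancel₀ (mul_pos hwp hD').ne' h1
  have a0 := aux _ _ e0
  have a1 := aux _ _ e1
  have fin : collapseCoord t 0 = collapseCoord t' 0 ∧ collapseCoord t 1 = collapseCoord t' 1 := by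
    rcases le_total (collapseWeight t) (collapseWeight t') with hle | hle
    · rw [hl, hl'] at hle a0 a1
      rw [hl] at hwp
      exact eq_of_weight_mul_eq (collapseCoord_sq_le t' 0) hwp hle a0 a1
    · rw [hl, hl'] at hle a0 a1
      rw [hl'] at hwp'
      obtain ⟨h1, h2⟩ := eq_of_weight_mul_eq (collapseCoord_sq_le t 0)
        hwp' hle a0.symm a1.symm
      exact ⟨h1.symm, h2.symm⟩
  funext i
  apply Subtype.ext
  have hc (i : Fin 2) (hi : collapseCoord t i = collapseCoord t' i) : (t i : ℝ) = t' i := by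
    unfold collapseCoord at hi; linarith
  fin_cases i
  · exact hc 0 fin.1
  · exact hc 1 fin.2

/-- This inverts $(u,v)\mapsto(u/w,v/w)$: the preimage of $(a,b)$ is $(ra,rb)$, where $r$ is its own
weight. The intermediate value theorem yields $r$ on $[0,1/m]$ with $m=\max(1,|a|,|b|)$. -/
theorem exists_weight_mul_eq (a b : ℝ) : ∃ r : ℝ, 0 < r ∧ (r * a) ^ 2 ≤ 1 ∧ (r * b) ^ 2 ≤ 1 ∧
    (1 - (r * a) ^ 2) * (1 - (r * b) ^ 2) = r := by
  have hsq {r c : ℝ} (hr : 0 ≤ r) (hrc : r * |c| ≤ 1) : (r * c) ^ 2 ≤ 1 := by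
    rw [← sq_abs, abs_mul, abs_of_nonneg hr]
    exact pow_le_one₀ (by positivity) hrc
  let m := max 1 (max |a| |b|)
  have hm1 : 1 ≤ m := le_max_left _ _
  have hm : 0 < m := by linarith
  have ha : |a| ≤ m := (le_max_left _ _).trans (le_max_right _ _)
  have hb : |b| ≤ m := (le_max_right _ _).trans (le_max_right _ _)
  have hbd {r c : ℝ} (hr : 0 ≤ r) (hrm : r ≤ m⁻¹) (hc : |c| ≤ m) : (r * c) ^ 2 ≤ 1 := by
    apply hsq hr
    calc r * |c| ≤ m⁻¹ * m := by gcongr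
      _ = 1 := inv_mul_cancel₀ hm.ne'
  let f : ℝ → ℝ := fun r => (1 - (r * a) ^ 2) * (1 - (r * b) ^ 2) - r
  have hf : ContinuousOn f (Set.Icc 0 m⁻¹) := by
    apply Continuous.continuousOn; fun_prop
  have hend : f m⁻¹ ≤ 0 := by
    have h1 := hbd (by positivity : 0 ≤ m⁻¹) le_rfl ha
    have h2 := hbd (by positivity : 0 ≤ m⁻¹) le_rfl hb
    have hone {c : ℝ} (hc : |c| = m) : (m⁻¹ * c) ^ 2 = 1 := by
      rw [← sq_abs, abs_mul, hc, abs_of_pos (inv_pos.2 hm), inv_mul_cancel₀ hm.ne', one_pow]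
    have hcase : m = 1 ∨ |a| = m ∨ |b| = m := by
      rcases max_choice 1 (max |a| |b|) with h | h
      · exact Or.inl h
      · rcases max_choice |a| |b| with h' | h'
        · exact Or.inr (Or.inl (h'.symm.trans h.symm))
        · exact Or.inr (Or.inr (h'.symm.trans h.symm))
    have hinv : 0 < m⁻¹ := inv_pos.2 hm
    simp only [f]
    rcases hcase with h | h | h
    · rw [h] at h1 h2 ⊢
      have := mul_le_one₀ (a := 1 - (1⁻¹ * a) ^ 2) (b := 1 - (1⁻¹ * b) ^ 2)
        (by nlinarith [sq_nonneg ((1:ℝ)⁻¹ * a)]) (by linarith)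
        (by nlinarith [sq_nonneg ((1:ℝ)⁻¹ * b)])
      linarith [inv_one (G := ℝ)]
    · rw [hone h]; linarith
    · rw [hone h]; linarith
  have h0 : 0 ≤ f 0 := by simp [f]
  obtain ⟨r, hr, hfr⟩ := intermediate_value_Icc' (inv_pos.2 hm).le hf ⟨hend, h0⟩
  refine ⟨r, lt_of_le_of_ne hr.1 ?_, hbd hr.1 hr.2 ha, hbd hr.1 hr.2 hb, by
    simp only [f] at hfr; linarith⟩
  rintro rfl
  simp [f] at hfr

theorem collapse_surjective : Function.Surjective collapse := by
  rintro ⟨p, hp⟩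
  have hn : p 0 ^ 2 + p 1 ^ 2 + p 2 ^ 2 = 1 := by
    rw [mem_sphere_zero_iff_norm, EuclideanSpace.norm_eq, Real.sqrt_eq_one] at hp
    simpa [Fin.sum_univ_three] using hp
  by_cases h2 : p 2 = 1
  · refine ⟨fun _ => 0, ?_⟩
    rw [collapse_boundary _ ⟨0, Or.inl rfl⟩]
    apply Subtype.ext
    have h0 : p 0 = 0 := by nlinarith [sq_nonneg (p 0), sq_nonneg (p 1)]
    have h1 : p 1 = 0 := by nlinarith [sq_nonneg (p 0), sq_nonneg (p 1)]
    ext i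
    fin_cases i <;> simp [northPole, h0, h1, h2]
  have h2' : 0 < 1 - p 2 := by
    have : p 2 ≤ 1 := by nlinarith [sq_nonneg (p 0), sq_nonneg (p 1)]
    exact sub_pos.2 (lt_of_le_of_ne this h2)
  -- Stereographic coordinates of `p` from the north pole.
  obtain ⟨a, ha⟩ : ∃ a, a = p 0 / (1 - p 2) := ⟨_, rfl⟩
  obtain ⟨b, hb⟩ : ∃ b, b = p 1 / (1 - p 2) := ⟨_, rfl⟩
  rw [eq_div_iff h2'.ne'] at ha hb
  obtain ⟨r, hr, hra, hrb, hw⟩ := exists_weight_mul_eq a b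
  have hI {c : ℝ} (hc : c ^ 2 ≤ 1) : (c + 1) / 2 ∈ I := by
    have := abs_le_one_iff_mul_self_le_one.2 (by nlinarith : c * c ≤ 1)
    have := abs_le.1 this
    constructor <;> linarith
  let t : Fin 2 → I := ![⟨_, hI hra⟩, ⟨_, hI hrb⟩]
  have t0 : collapseCoord t 0 = r * a := by simp [collapseCoord, t]; ring
  have t1 : collapseCoord t 1 = r * b := by simp [collapseCoord, t]; ring
  have tw : collapseWeight t = r := by rw [collapseWeight, t0, t1, hw]
  have td : collapseDenom t = r ^ 2 * (a ^ 2 + b ^ 2 + 1) := by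
    rw [collapseDenom, t0, t1, tw]; ring
  have hsum : (a ^ 2 + b ^ 2 + 1) * (1 - p 2) = 2 := by
    have : (a ^ 2 + b ^ 2 + 1) * (1 - p 2) * (1 - p 2) = 2 * (1 - p 2) := by
      calc _ = (a * (1 - p 2)) ^ 2 + (b * (1 - p 2)) ^ 2 + (1 - p 2) ^ 2 := by ring
        _ = _ := by rw [ha, hb]; linarith
    exact mul_right_cancel₀ h2'.ne' this
  have hs : 0 < a ^ 2 + b ^ 2 + 1 := by positivity
  refine ⟨t, Subtype.ext ?_⟩
  change collapseVec t = p
  have hrs : r ^ 2 * (a ^ 2 + b ^ 2 + 1) ≠ 0 := by positivity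
  ext i
  fin_cases i
  · simp only [collapseVec, t0, t1, tw, td]
    change 2 * (r * a) * r / _ = p 0
    rw [div_eq_iff hrs, ← ha]
    linear_combination (-r ^ 2 * a) * hsum
  · simp only [collapseVec, t0, t1, tw, td]
    change 2 * (r * b) * r / _ = p 1
    rw [div_eq_iff hrs, ← hb]
    linear_combination (-r ^ 2 * b) * hsum
  · simp only [collapseVec, t0, t1, tw, td]
    change ((r * a) ^ 2 + (r * b) ^ 2 - r ^ 2) / _ = p 2
    rw [div_eq_iff hrs]
    linear_combination (r ^ 2) * hsum

theorem exists_comp_collapse_eq {X : Type*} [TopologicalSpace X] (g : C(Fin 2 → I, X)) (x : X)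
    (hg : ∀ t ∈ Cube.boundary (Fin 2), g t = x) : ∃ f : C(Sphere2, X), f.comp collapse = g := by
  have hq : Topology.IsQuotientMap collapse :=
    .of_surjective_continuous collapse_surjective collapse.continuous
  refine ⟨hq.lift g fun t t' h => ?_, hq.lift_comp g _⟩
  rcases collapse_eq_iff h with rfl | ⟨h, h'⟩
  · rfl
  · rw [hg t h, hg t' h']

/-- Lift over the contractible square instead. On each edge the lift stays in the fibre over the
image of the north pole, so it is constant there; adjacent edges meet, so it is constant on the
boundary and descends to the sphere. -/
theorem exists_sphere_lift {E X : Type*} [TopologicalSpace E] [TopologicalSpace X] {p : C(E, X)}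
    (cov : IsCoveringMap p) (f : C(Sphere2, X)) (e₀ : E) (he : p e₀ = f northPole) :
    ∃ F : C(Sphere2, E), F northPole = e₀ ∧ ∀ s, p (F s) = f s := by
  have : LocallyPathConnectedSpace I := (convex_Icc (0 : ℝ) 1).locallyPathConnectedSpace
  have : ContractibleSpace I := (convex_Icc (0 : ℝ) 1).contractibleSpace ⟨0, by simp⟩
  let ψ : (Fin 2 → I) ≃ₜ I × I := Homeomorph.finTwoArrow
  have : LocallyPathConnectedSpace (Fin 2 → I) := ψ.isOpenEmbedding.locallyPathConnectedSpace
  have : ContractibleSpace (Fin 2 → I) := ψ.contractibleSpace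
  have h0 : (fun _ => 0 : Fin 2 → I) ∈ Cube.boundary (Fin 2) := ⟨0, Or.inl rfl⟩
  obtain ⟨G, ⟨hG0, hG⟩, -⟩ := cov.existsUnique_continuousMap_lifts (f.comp collapse)
    (fun _ => 0) e₀ (by rw [he, ContinuousMap.comp_apply, collapse_boundary _ h0])
  have hedge {t t' : Fin 2 → I} {i : Fin 2} {ε : I} (hε : ε = 0 ∨ ε = 1) (ht : t i = ε)
      (ht' : t' i = ε) : G t = G t' := by
    have hpre : IsPreconnected (Set.range fun t : Fin 2 → I => Function.update t i ε) :=
      isPreconnected_range (by fun_prop)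
    have hb (s : Fin 2 → I) : p (G (Function.update s i ε)) = f northPole := by
      refine (congrFun hG _).trans ?_
      rw [ContinuousMap.comp_apply, collapse_boundary]
      exact ⟨i, by simpa using hε⟩
    refine cov.constOn_of_comp hpre G.continuous.continuousOn ?_ ⟨t, ?_⟩ ⟨t', ?_⟩
    · rintro _ ⟨s, rfl⟩ _ ⟨s', rfl⟩
      rw [hb, hb]
    · rw [← ht]; simp
    · rw [← ht']; simp
  have hbd (t : Fin 2 → I) (ht : t ∈ Cube.boundary (Fin 2)) : G t = e₀ := by
    obtain ⟨i, hi⟩ := ht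
    have hne : i + 1 ≠ i := by fin_cases i <;> decide
    -- In `Fin 2`, `i + 1` is the other coordinate. Move along the edge through `t` to a corner with
    -- that coordinate 0, then along the edge there to the origin.
    rw [hedge (t' := Function.update t (i + 1) 0) hi rfl (by simp [hne.symm]), ← hG0]
    exact hedge (i := i + 1) (Or.inl rfl) (by simp) rfl
  obtain ⟨F, hF⟩ := exists_comp_collapse_eq G e₀ hbd
  refine ⟨F, ?_, fun s => ?_⟩
  · rw [← collapse_boundary _ h0, ← hG0, ← hF]; rfl
  · obtain ⟨t, rfl⟩ := collapse_surjective s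
    exact (congrArg p (DFunLike.congr_fun hF t)).trans (congrFun hG t)

/-! ### From the universal covering to a finite one -/

theorem fundamentalGroup_map_eq_one_of_factor {A B E : Type*} [TopologicalSpace A]
    [TopologicalSpace B] [TopologicalSpace E] [SimplyConnectedSpace E] {f : C(A, B)} (k : C(A, E))
    (g : C(E, B)) (h : f = g.comp k) (z : A) : FundamentalGroup.map f z = 1 := by
  subst h
  ext γ
  change Path.Homotopic.Quotient.map γ _ = .refl _
  rw [Path.Homotopic.Quotient.map_comp,
    Subsingleton.elim (Path.Homotopic.Quotient.map γ k) (.refl _)]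
  rfl

/-- Intersect finitely many normal subgroups of finite index, one missing each nontrivial element of
`T`. -/
theorem exists_finite_quotient {G : Type u} [Group G] [Group.ResiduallyFinite G] {T : Set G}
    (hT : T.Finite) : ∃ (Q : Type u) (_ : Group Q) (_ : Finite Q) (φ : G →* Q),
      Function.Surjective φ ∧ ∀ g ∈ T, φ g = 1 → g = 1 := by
  have h : ∃ N : Subgroup G, N.Normal ∧ N.FiniteIndex ∧ ∀ g ∈ T, g ∈ N → g = 1 := by
    induction T, hT using Set.Finite.induction_on with
    | empty => exact ⟨⊤, inferInstance, inferInstance, by simp⟩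
    | @insert a s _ _ ih =>
      obtain ⟨N, h1, h2, h3⟩ := ih
      by_cases ha : a = 1
      · refine ⟨N, h1, h2, ?_⟩
        rintro g (rfl | hg) hgN
        exacts [ha, h3 g hg hgN]
      · obtain ⟨H, hH⟩ := Group.exists_finiteIndexNormalSubgroup_notMem a ha
        refine ⟨N ⊓ H.toSubgroup, inferInstance, inferInstance, ?_⟩
        rintro g (rfl | hg) hgN
        exacts [absurd hgN.2 hH, h3 g hg hgN.1]
  obtain ⟨N, h1, h2, h3⟩ := h
  exact ⟨G ⧸ N, inferInstance, inferInstance, QuotientGroup.mk' N, QuotientGroup.mk'_surjective N,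
    fun g hg h => h3 g hg ((QuotientGroup.eq_one_iff g).1 h)⟩

namespace FlatPaths

variable {M : Type u} [TopologicalSpace M] {x : M} (S : FlatPaths x)
  {Q : Type u} [Group Q] [TopologicalSpace Q] [DiscreteTopology Q]
  [LocallyPathConnectedSpace M] (φ : FundamentalGroup M x →* Q)

theorem t2Space_cover [T2Space M] : T2Space (S.Cover φ) := by
  refine ⟨fun e e' hne => ?_⟩
  by_cases h : S.proj φ e = S.proj φ e'
  · exact (S.isCoveringMap_proj φ).isSeparatedMap e e' h hne
  · exact separated_by_continuous (S.proj φ).continuous h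

/-- Countably many members of the open cover suffice, and over each the covering is a product with
the countable discrete space `Q`. -/
theorem secondCountableTopology_cover [SecondCountableTopology M] [Countable Q] :
    SecondCountableTopology (S.Cover φ) := by
  obtain ⟨T, hT, hTU⟩ := TopologicalSpace.isOpen_iUnion_countable S.U S.isOpen_U
  have := hT.to_subtype
  let W (i : T) : Set (S.Cover φ) := S.proj φ ⁻¹' S.U i
  have hW (i : T) : SecondCountableTopology (W i) :=
    (((S.core φ).localTriv i).preimageHomeomorph (s := S.U i)
      subset_rfl).isEmbedding.secondCountableTopology
  refine TopologicalSpace.secondCountableTopology_of_countable_cover (U := W)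
    (fun i => (S.isOpen_U _).preimage (S.proj φ).continuous) ?_
  refine Set.eq_univ_of_forall fun e => ?_
  have h : S.proj φ e ∈ ⋃ i ∈ T, S.U i := by
    rw [hTU]; exact Set.mem_iUnion.2 ⟨_, S.mem_U _⟩
  obtain ⟨i, hi, h⟩ := Set.mem_iUnion₂.1 h
  exact Set.mem_iUnion.2 ⟨⟨i, hi⟩, h⟩

theorem finite_fiber [Finite Q] (m : M) : (S.proj φ ⁻¹' {m}).Finite := by
  refine Set.Finite.of_finite_image (f := S.coord φ) (Set.toFinite _) ?_
  intro e he e' he' h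
  exact S.cover_ext (he.trans he'.symm) h

theorem surjective_proj : Function.Surjective (S.proj φ) := fun m => ⟨⟨m, (1 : Q)⟩, rfl⟩

variable {φ} in
-- Coordinate changes multiply on the left, so `g⁻¹ * g'` for two points of one fibre does not
-- depend on the trivialization. It is thus locally constant on the pairs with equal projection, a
-- closed subset of a compact space because `M` is Hausdorff.
theorem finite_differences [T2Space M] {X : Type*} [TopologicalSpace X] [CompactSpace X]
    (F : C(X, S.Cover φ)) : {q : Q | ∃ s t, S.proj φ (F s) = S.proj φ (F t) ∧
      (S.coord φ (F s))⁻¹ * S.coord φ (F t) = q}.Finite := by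
  let D : Set (X × X) := {st | S.proj φ (F st.1) = S.proj φ (F st.2)}
  have hD : IsClosed D := isClosed_eq (by fun_prop) (by fun_prop)
  have : CompactSpace D := isCompact_iff_compactSpace.1 hD.isCompact
  let d (st : D) : Q := (S.coord φ (F st.1.1))⁻¹ * S.coord φ (F st.1.2)
  have hd : IsLocallyConstant d := by
    rw [IsLocallyConstant.iff_eventually_eq]
    rintro ⟨⟨s, t⟩, hst⟩
    have hs := ((S.continuousAt_cover_iff (f := F) (s := s)).1 F.continuous.continuousAt).2
    have ht := ((S.continuousAt_cover_iff (f := F) (s := t)).1 F.continuous.continuousAt).2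
    have h1 : Filter.Tendsto (fun st : D => st.1.1) (𝓝 ⟨(s, t), hst⟩) (𝓝 s) :=
      (continuous_fst.comp continuous_subtype_val).continuousAt
    have h2 : Filter.Tendsto (fun st : D => st.1.2) (𝓝 ⟨(s, t), hst⟩) (𝓝 t) :=
      (continuous_snd.comp continuous_subtype_val).continuousAt
    filter_upwards [h1.eventually hs, h2.eventually ht]
    rintro ⟨⟨s', t'⟩, hst'⟩ hs' ht'
    replace hst : S.proj φ (F s) = S.proj φ (F t) := hst
    replace hst' : S.proj φ (F s') = S.proj φ (F t') := hst'
    simp only at hs' ht'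
    simp only [d]
    rw [← hs', ← ht', ← hst, ← hst']
    group
  refine hd.range_finite.subset ?_
  rintro q ⟨s, t, hst, rfl⟩
  exact ⟨⟨(s, t), hst⟩, rfl⟩

theorem exists_lift_fundamentalGroup_map_eq_one [T2Space M] [PathConnectedSpace M]
    [Group.ResiduallyFinite (FundamentalGroup M x)] (h : C(Sphere2, M)) :
    ∃ (Q : Type u) (_ : Group Q) (_ : Finite Q) (_ : TopologicalSpace Q) (_ : DiscreteTopology Q)
      (φ : FundamentalGroup M x →* Q) (h' : C(Sphere2, S.Cover φ)),
      Function.Surjective φ ∧ (∀ s, S.proj φ (h' s) = h s) ∧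
      ∀ z, FundamentalGroup.map (inclusionMap (Set.range h')) z = 1 := by
  -- `P` is the fundamental group with the discrete topology, made opaque to keep this topology
  -- apart from any other on that type. Its covering is the universal one.
  obtain ⟨P, hP, τP, hdP, ⟨e⟩⟩ : ∃ (P : Type u) (_ : Group P) (_ : TopologicalSpace P)
      (_ : DiscreteTopology P), Nonempty (FundamentalGroup M x ≃* P) :=
    ⟨FundamentalGroup M x, inferInstance, ⊥, discreteTopology_bot _, ⟨MulEquiv.refl _⟩⟩
  let φ₀ : FundamentalGroup M x →* P := e.toMonoidHom
  have hφ₀ : Function.Bijective φ₀ := e.bijective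
  have := S.simplyConnectedSpace_cover φ₀ hφ₀
  obtain ⟨F, -, hF⟩ := exists_sphere_lift (S.isCoveringMap_proj φ₀) h ⟨h northPole, (1 : P)⟩ rfl
  obtain ⟨Q, hQ, hfin, ψ, hψ, hT⟩ := exists_finite_quotient
    ((S.finite_differences F).image e.symm)
  let _ : TopologicalSpace Q := ⊥
  have : DiscreteTopology Q := discreteTopology_bot _
  let ψ' : P →* Q := ψ.comp e.symm.toMonoidHom
  let κ := S.coverMap φ₀ ψ'
  have hψ' : ψ'.comp φ₀ = ψ := by ext; simp [ψ', φ₀]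
  let h' : C(Sphere2, S.Cover (ψ'.comp φ₀)) := κ.comp F
  have := S.t2Space_cover (ψ'.comp φ₀)
  -- The crux: `h'` identifies no more points than `F` does, since a difference occurring for `F`
  -- and killed in `Q` is trivial.
  have hinj {s t : Sphere2} (hst : h' s = h' t) : F s = F t := by
    have h1 : S.proj φ₀ (F s) = S.proj φ₀ (F t) := congrArg (S.proj (ψ'.comp φ₀)) hst
    have h2 : ψ' (S.coord φ₀ (F s)) = ψ' (S.coord φ₀ (F t)) :=
      congrArg (S.coord (ψ'.comp φ₀)) hst
    refine S.cover_ext h1 ?_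
    have h3 := hT _ ⟨_, ⟨s, t, h1, rfl⟩, rfl⟩ (by
      change ψ' _ = 1
      rw [map_mul, map_inv, h2, inv_mul_cancel])
    rw [MulEquivClass.map_eq_one_iff] at h3
    exact inv_mul_eq_one.1 h3
  -- The sphere is compact and the finite covering Hausdorff, so the image carries the quotient
  -- topology and `F` descends continuously to it.
  have hq : Topology.IsQuotientMap (Set.rangeFactorization h') :=
    .of_surjective_continuous Set.rangeFactorization_surjective
      (h'.continuous.subtype_mk _)
  have hfac : Function.FactorsThrough F (Set.rangeFactorization h') := fun s t hst =>
    hinj (congrArg Subtype.val hst)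
  let θ : C(Set.range h', S.Cover φ₀) :=
    Topology.IsQuotientMap.lift (f := ⟨_, hq.continuous⟩) hq F hfac
  have hθ (s : Sphere2) : θ (Set.rangeFactorization h' s) = F s :=
    DFunLike.congr_fun (Topology.IsQuotientMap.lift_comp (f := ⟨_, hq.continuous⟩) hq F hfac) s
  refine ⟨Q, hQ, hfin, inferInstance, inferInstance, ψ'.comp φ₀, h', by rwa [hψ'], hF, ?_⟩
  refine fundamentalGroup_map_eq_one_of_factor θ κ ?_
  ext1 z
  obtain ⟨s, rfl⟩ := Set.rangeFactorization_surjective z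
  rw [ContinuousMap.comp_apply, hθ]
  rfl

end FlatPaths

theorem exists_isSimplyConnected_nhd {E M : Type*} [NormedAddCommGroup E] [NormedSpace ℝ E]
    [TopologicalSpace M] [ChartedSpace E M] (y : M) :
    ∃ U : Set M, IsOpen U ∧ y ∈ U ∧ IsSimplyConnected U := by
  let e := chartAt E y
  obtain ⟨ε, hε, hB⟩ := Metric.isOpen_iff.1 e.open_target (e y) (mem_chart_target E y)
  refine ⟨e.symm '' Metric.ball (e y) ε, e.symm.isOpen_image_of_subset_source Metric.isOpen_ball hB,
    ⟨e y, Metric.mem_ball_self hε, e.left_inv (mem_chart_source E y)⟩, ?_⟩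
  have : ContractibleSpace (Metric.ball (e y) ε) :=
    (convex_ball _ _).contractibleSpace ⟨_, Metric.mem_ball_self hε⟩
  exact (e.symm.homeomorphOfImageSubsetSource hB rfl).symm.toHomotopyEquiv.simplyConnectedSpace

/-! ### Smooth structures and immersions pulled back along a local homeomorphism -/

section LocalHomeomorph

variable {H X M : Type*} [TopologicalSpace H] [TopologicalSpace X] [TopologicalSpace M]

/-- Both `L` and `L'` are the map `p` itself, so `L' ∘ L.symm` is the identity where defined, and
the coordinate change upstairs is a restriction of the one downstairs. -/
theorem trans_symm_trans_mem_groupoid (G : StructureGroupoid H) [ClosedUnderRestriction G]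
    {p : X → M} {L L' : OpenPartialHomeomorph X M} (hL : p = L) (hL' : p = L')
    {c c' : OpenPartialHomeomorph M H} (h : c.symm.trans c' ∈ G) :
    (L.trans c).symm.trans (L'.trans c') ∈ G := by
  let T := (L.trans c).symm.trans (L'.trans c')
  refine G.mem_of_eqOnSource (closedUnderRestriction' h T.open_source) ?_
  have key : ∀ y ∈ T.source, L' (L.symm (c.symm y)) = c.symm y := by
    intro y hy
    have hy1 : c.symm y ∈ L.target := by
      have := hy.1; simp at this; exact this.2
    rw [← hL', hL, L.right_inv hy1]
  have hsub : T.source ⊆ (c.symm.trans c').source := by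
    intro y hy
    have h1 : y ∈ c.target := by have := hy.1; simp at this; exact this.1
    have h2 : L' (L.symm (c.symm y)) ∈ c'.source := by have := hy.2; simp at this; exact this.2
    rw [key y hy] at h2
    exact ⟨h1, h2⟩
  constructor
  · rw [OpenPartialHomeomorph.restr_source, T.open_source.interior_eq]
    exact (Set.inter_eq_right.2 hsub).symm
  · intro y hy
    change c' (L' (L.symm (c.symm y))) = c' (c.symm y)
    rw [key y hy]

variable [ChartedSpace H M]

/-- The charted space structure pulled back along a local homeomorphism. -/
@[reducible]
def IsLocalHomeomorph.pullbackChartedSpace {p : X → M} (hp : IsLocalHomeomorph p) :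
    ChartedSpace H X where
  atlas := Set.range fun e => (hp e).choose.trans (chartAt H (p e))
  chartAt e := (hp e).choose.trans (chartAt H (p e))
  mem_chart_source e := by
    have h := (hp e).choose_spec
    refine ⟨h.1, ?_⟩
    change (hp e).choose e ∈ (chartAt H (p e)).source
    rw [← h.2]
    exact mem_chart_source H (p e)
  chart_mem_atlas e := ⟨e, rfl⟩

theorem IsLocalHomeomorph.pullback_hasGroupoid (G : StructureGroupoid H) [ClosedUnderRestriction G]
    [HasGroupoid M G] {p : X → M} (hp : IsLocalHomeomorph p) :
    let _ := hp.pullbackChartedSpace (H := H); HasGroupoid X G := by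
  let _ := hp.pullbackChartedSpace (H := H)
  constructor
  rintro _ _ ⟨e, rfl⟩ ⟨e', rfl⟩
  exact trans_symm_trans_mem_groupoid G (hp e).choose_spec.2 (hp e').choose_spec.2
    (G.compatible (chart_mem_atlas H _) (chart_mem_atlas H _))

theorem IsLocalHomeomorph.trans_mem_maximalAtlas (G : StructureGroupoid H)
    [ClosedUnderRestriction G] [HasGroupoid M G] {p : X → M} (hp : IsLocalHomeomorph p)
    {L : OpenPartialHomeomorph X M} (hL : p = L) {c : OpenPartialHomeomorph M H}
    (hc : c ∈ G.maximalAtlas M) :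
    let _ := hp.pullbackChartedSpace (H := H); L.trans c ∈ G.maximalAtlas X := by
  let _ := hp.pullbackChartedSpace (H := H)
  rw [mem_maximalAtlas_iff]
  rintro _ ⟨e, rfl⟩
  have h := mem_maximalAtlas_iff.1 hc _ (chart_mem_atlas H (p e))
  exact ⟨trans_symm_trans_mem_groupoid G hL (hp e).choose_spec.2 h.1,
    trans_symm_trans_mem_groupoid G (hp e).choose_spec.2 hL h.2⟩

end LocalHomeomorph

section Smooth

variable {E E' X M : Type*} [NormedAddCommGroup E] [NormedSpace ℝ E] [NormedAddCommGroup E']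
  [NormedSpace ℝ E'] [TopologicalSpace X]
  [TopologicalSpace M] [ChartedSpace E M] [IsManifold 𝓘(ℝ, E) ∞ M]

theorem IsLocalHomeomorph.pullback_isManifold {p : X → M} (hp : IsLocalHomeomorph p) :
    let _ := hp.pullbackChartedSpace (H := E); IsManifold 𝓘(ℝ, E) ∞ X := by
  let _ := hp.pullbackChartedSpace (H := E)
  have := hp.pullback_hasGroupoid (contDiffGroupoid ∞ 𝓘(ℝ, E))
  exact IsManifold.mk' _ _ _

/-- In the charts `L.trans c` and `c`, the map `p` is the identity. -/
theorem IsLocalHomeomorph.isLocalDiffeomorph_pullback {p : X → M} (hp : IsLocalHomeomorph p) :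
    let _ := hp.pullbackChartedSpace (H := E); IsLocalDiffeomorph 𝓘(ℝ, E) 𝓘(ℝ, E) ∞ p := by
  intro _
  have := hp.pullback_isManifold (E := E)
  intro e
  obtain ⟨L, he, hL⟩ := hp e
  have hmem (m : M) : L.trans (chartAt E m) ∈ IsManifold.maximalAtlas 𝓘(ℝ, E) ∞ X :=
    IsLocalHomeomorph.trans_mem_maximalAtlas (contDiffGroupoid ∞ 𝓘(ℝ, E)) hp hL
      (IsManifold.chart_mem_maximalAtlas m)
  have hchart (m : M) : chartAt E m ∈ IsManifold.maximalAtlas 𝓘(ℝ, E) ∞ M :=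
    IsManifold.chart_mem_maximalAtlas m
  refine ⟨⟨L.toPartialEquiv, L.open_source, L.open_target, ?_, ?_⟩, he, fun _ _ => congrFun hL _⟩
  · intro e₁ he₁
    apply ContMDiffAt.contMDiffWithinAt
    let c := chartAt E (L e₁)
    have h₁ : e₁ ∈ (L.trans c).source := ⟨he₁, mem_chart_source E (L e₁)⟩
    have h₂ := (contMDiffAt_symm_of_mem_maximalAtlas (hchart (L e₁)) (mem_chart_target E (L e₁))).comp e₁
      (contMDiffAt_of_mem_maximalAtlas (hmem (L e₁)) h₁)
    refine h₂.congr_of_eventuallyEq ?_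
    filter_upwards [(L.trans c).open_source.mem_nhds h₁] with e₂ he₂
    exact (c.left_inv he₂.2).symm
  · intro m hm
    apply ContMDiffAt.contMDiffWithinAt
    let c := chartAt E m
    have h₁ : c m ∈ (L.trans c).target :=
      ⟨mem_chart_target E m, by simpa [c, c.left_inv (mem_chart_source E m)] using hm⟩
    have h₂ := (contMDiffAt_symm_of_mem_maximalAtlas (hmem m) h₁).comp m
      (contMDiffAt_of_mem_maximalAtlas (hchart m) (mem_chart_source E m))
    refine h₂.congr_of_eventuallyEq ?_
    filter_upwards [c.open_source.mem_nhds (mem_chart_source E m)] with m' hm'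
    exact congrArg L.symm (c.left_inv hm').symm

/-- With the codomain chart composed with a local branch `L` of `p`, the lift has the same local
expression as `h`, hence the same normal form. -/
theorem IsImmersionAtOfComplement_lift {F S H' : Type*} [NormedAddCommGroup F] [NormedSpace ℝ F]
    [TopologicalSpace H'] {I' : ModelWithCorners ℝ E' H'}
    [TopologicalSpace S] [ChartedSpace H' S] {p : X → M} (hp : IsLocalHomeomorph p) {h : S → M}
    {h' : S → X} (hh' : Continuous h') (hph : ∀ s, p (h' s) = h s) (s : S)
    (him : Manifold.IsImmersionAtOfComplement F I' 𝓘(ℝ, E) ∞ h s) :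
    let _ := hp.pullbackChartedSpace (H := E)
    Manifold.IsImmersionAtOfComplement F I' 𝓘(ℝ, E) ∞ h' s := by
  let _ := hp.pullbackChartedSpace (H := E)
  obtain ⟨L, he, hL⟩ := hp (h' s)
  have hpL (s : S) : L (h' s) = h s := by rw [← hL, hph]
  refine .mk_of_continuousAt hh'.continuousAt him.equiv him.domChart (L.trans him.codChart)
    him.mem_domChart_source ⟨he, ?_⟩ him.domChart_mem_maximalAtlas
    (hp.trans_mem_maximalAtlas (contDiffGroupoid ∞ 𝓘(ℝ, E)) hL him.codChart_mem_maximalAtlas) ?_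
  · change L (h' s) ∈ him.codChart.source
    rw [hpL]; exact him.mem_codChart_source
  · intro y hy
    rw [← him.writtenInCharts hy]
    simp [hpL]

end Smooth

/-! ### Injective derivative implies the local normal form of an immersion -/

section

variable {E E' F S M : Type*} [NormedAddCommGroup E] [NormedSpace ℝ E] [NormedAddCommGroup E']
  [NormedSpace ℝ E'] [NormedAddCommGroup F] [NormedSpace ℝ F] [TopologicalSpace S]
  [ChartedSpace E S] [IsManifold 𝓘(ℝ, E) ∞ S]
  [TopologicalSpace M] [ChartedSpace E' M] [IsManifold 𝓘(ℝ, E') ∞ M]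

theorem mdifferentiable_of_mem_maximalAtlas {e : OpenPartialHomeomorph S E}
    (he : e ∈ IsManifold.maximalAtlas 𝓘(ℝ, E) ∞ S) : e.MDifferentiable 𝓘(ℝ, E) 𝓘(ℝ, E) := by
  rw [IsManifold.mem_maximalAtlas_iff_contMDiffOn] at he
  exact ⟨he.1.mdifferentiableOn (by simp), he.2.mdifferentiableOn (by simp)⟩

theorem injective_mfderiv_iff {f : S → M} {s : S} (hf : ContMDiffAt 𝓘(ℝ, E) 𝓘(ℝ, E') ∞ f s)
    {e : OpenPartialHomeomorph S E} (he : e ∈ IsManifold.maximalAtlas 𝓘(ℝ, E) ∞ S)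
    (hs : s ∈ e.source) {ψ : OpenPartialHomeomorph M E'}
    (hψ : ψ ∈ IsManifold.maximalAtlas 𝓘(ℝ, E') ∞ M) (hfs : f s ∈ ψ.source) :
    Function.Injective (mfderiv 𝓘(ℝ, E) 𝓘(ℝ, E') f s) ↔
      Function.Injective (fderiv ℝ (ψ ∘ f ∘ e.symm) (e s)) := by
  have he' := (mdifferentiable_of_mem_maximalAtlas he).symm
  have hψ' := mdifferentiable_of_mem_maximalAtlas hψ
  have h1 : MDifferentiableAt 𝓘(ℝ, E) 𝓘(ℝ, E) e.symm (e s) :=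
    he'.mdifferentiableAt (e.map_source hs)
  have hes : e.symm (e s) = s := e.left_inv hs
  have h2 : MDifferentiableAt 𝓘(ℝ, E) 𝓘(ℝ, E') f (e.symm (e s)) := by
    rw [hes]; exact hf.mdifferentiableAt (by simp)
  have h3 : MDifferentiableAt 𝓘(ℝ, E') 𝓘(ℝ, E') ψ ((f ∘ e.symm) (e s)) := by
    refine hψ'.mdifferentiableAt ?_
    rw [Function.comp_apply, hes]; exact hfs
  rw [← mfderiv_eq_fderiv, mfderiv_comp _ h3 (h2.comp _ h1), mfderiv_comp _ h2 h1]
  have b1 := he'.mfderiv_bijective (e.map_source hs)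
  have b3 : Function.Injective (mfderiv 𝓘(ℝ, E') 𝓘(ℝ, E') ψ ((f ∘ e.symm) (e s))) := by
    refine (hψ'.mfderiv_bijective ?_).1
    rw [Function.comp_apply, hes]; exact hfs
  have key : Function.Injective (mfderiv 𝓘(ℝ, E) 𝓘(ℝ, E') f s) ↔
      Function.Injective (mfderiv 𝓘(ℝ, E) 𝓘(ℝ, E') f (e.symm (e s))) := by rw [hes]
  rw [key]
  constructor
  · intro h
    exact b3.comp (h.comp b1.1)
  · intro h
    have h4 : Function.Injective (mfderiv 𝓘(ℝ, E) 𝓘(ℝ, E') f (e.symm (e s)) ∘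
        mfderiv 𝓘(ℝ, E) 𝓘(ℝ, E) e.symm (e s)) := Function.Injective.of_comp h
    exact Function.Injective.of_comp_right h4 b1.2

theorem exists_continuousLinearEquiv_extend [FiniteDimensional ℝ E] [FiniteDimensional ℝ E']
    [FiniteDimensional ℝ F]
    (hdim : Module.finrank ℝ E + Module.finrank ℝ F = Module.finrank ℝ E') {L : E →L[ℝ] E'}
    (hL : Function.Injective L) : ∃ Λ : (E × F) ≃L[ℝ] E', ∀ v, Λ (v, 0) = L v := by
  obtain ⟨C, hC⟩ := (LinearMap.range (L : E →ₗ[ℝ] E')).exists_isCompl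
  have h1 := Submodule.finrank_add_eq_of_isCompl hC
  rw [LinearMap.finrank_range_of_inj hL] at h1
  let ι : F ≃ₗ[ℝ] C := LinearEquiv.ofFinrankEq _ _ (by omega)
  let Λ₀ : (E × F) →ₗ[ℝ] E' := (L : E →ₗ[ℝ] E').coprod (C.subtype ∘ₗ ι.toLinearMap)
  have hinj : Function.Injective Λ₀ := by
    rw [← LinearMap.ker_eq_bot, LinearMap.ker_eq_bot']
    rintro ⟨v, w⟩ h
    have h2 : L v + (ι w : E') = 0 := h
    have h3 : (ι w : E') = L (-v) := by rw [map_neg]; exact (neg_eq_of_add_eq_zero_right h2).symm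
    have h4 : (ι w : E') = 0 :=
      (Submodule.disjoint_def.1 hC.disjoint) _ (h3 ▸ ⟨-v, rfl⟩) (ι w).2
    have h5 : w = 0 := by simpa using h4
    rw [h4, add_zero] at h2
    rw [h5, hL (h2.trans (map_zero L).symm)]
    rfl
  let Λ := (LinearEquiv.ofInjectiveOfFinrankEq Λ₀ hinj
    (by rw [Module.finrank_prod, hdim])).toContinuousLinearEquiv
  exact ⟨Λ, fun v => by
    change Λ₀ (v, 0) = L v
    simp [Λ₀]⟩

theorem exists_openPartialHomeomorph_of_equiv [FiniteDimensional ℝ E]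
    [FiniteDimensional ℝ E'] {Φ : E → E'} {a : E} {W : Set E}
    (hW : IsOpen W) (ha : a ∈ W) (hΦ : ContDiffOn ℝ ∞ Φ W) (Λ : E ≃L[ℝ] E')
    (hΛ : HasFDerivAt Φ (Λ : E →L[ℝ] E') a) :
    ∃ T : OpenPartialHomeomorph E E', a ∈ T.source ∧ T.source ⊆ W ∧ (∀ y, T y = Φ y) ∧
      ContDiffOn ℝ ∞ T.symm T.target := by
  have := FiniteDimensional.complete ℝ E
  have hat (y : E) (hy : y ∈ W) : ContDiffAt ℝ ∞ Φ y := hΦ.contDiffAt (hW.mem_nhds hy)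
  let T₀ := (hat a ha).toOpenPartialHomeomorph Φ hΛ (by simp)
  have ha₀ : a ∈ T₀.source := (hat a ha).mem_toOpenPartialHomeomorph_source hΛ (by simp)
  -- Shrink to where the derivative is invertible, so that the inverse is smooth on the whole target
  -- and not only at the image of `a`.
  let V : Set E := W ∩ fderiv ℝ Φ ⁻¹' Set.range ((↑) : (E ≃L[ℝ] E') → E →L[ℝ] E')
  have hV : IsOpen V := (hΦ.continuousOn_fderiv_of_isOpen hW (by simp)).isOpen_inter_preimage hW
    ContinuousLinearEquiv.isOpen
  have haV : a ∈ V := ⟨ha, Λ, hΛ.fderiv.symm⟩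
  refine ⟨T₀.restrOpen V hV, ⟨ha₀, haV⟩, fun y hy => hy.2.1, fun y => rfl, ?_⟩
  intro z hz
  have hz' : T₀.symm z ∈ V := ((T₀.restrOpen V hV).map_target hz).2
  obtain ⟨Λ', hΛ'⟩ := hz'.2
  have := (T₀.restrOpen V hV).contDiffAt_symm (n := ∞) hz (f₀' := Λ') (by
    rw [hΛ']
    exact ((hat _ hz'.1).differentiableAt (by simp)).hasFDerivAt) (hat _ hz'.1)
  exact this.contDiffWithinAt

/-- Thicken the local expression `G` to `Φ (y, w) = G y + B w`, where `B` fills a complement of the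
image of the derivative. By the inverse function theorem `Φ` is a local diffeomorphism, and its
inverse straightens the image of `f` to `y ↦ (y, 0)`. -/
theorem isImmersionAtOfComplement_of_injective [FiniteDimensional ℝ E] [FiniteDimensional ℝ E']
    [FiniteDimensional ℝ F]
    (hdim : Module.finrank ℝ E + Module.finrank ℝ F = Module.finrank ℝ E') {f : S → M}
    (hf : ContMDiff 𝓘(ℝ, E) 𝓘(ℝ, E') ∞ f) {s : S}
    (hinj : Function.Injective (mfderiv 𝓘(ℝ, E) 𝓘(ℝ, E') f s)) :
    Manifold.IsImmersionAtOfComplement F 𝓘(ℝ, E) 𝓘(ℝ, E') ∞ f s := by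
  let e := chartAt E s
  let ψ := chartAt E' (f s)
  have he : e ∈ IsManifold.maximalAtlas 𝓘(ℝ, E) ∞ S := IsManifold.chart_mem_maximalAtlas s
  have hψ : ψ ∈ IsManifold.maximalAtlas 𝓘(ℝ, E') ∞ M := IsManifold.chart_mem_maximalAtlas (f s)
  have hs : s ∈ e.source := mem_chart_source E s
  have hfs : f s ∈ ψ.source := mem_chart_source E' (f s)
  let G : E → E' := ψ ∘ f ∘ e.symm
  let W : Set E := e.target ∩ e.symm ⁻¹' (f ⁻¹' ψ.source)
  have hW : IsOpen W := e.symm.isOpen_inter_preimage (ψ.open_source.preimage hf.continuous)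
  have hesW : e s ∈ W := ⟨e.map_source hs, by
    change f (e.symm (e s)) ∈ ψ.source
    rwa [e.left_inv hs]⟩
  have hG : ContDiffOn ℝ ∞ G W := by
    rw [← contMDiffOn_iff_contDiffOn]
    exact (contMDiffOn_of_mem_maximalAtlas hψ).comp
      (hf.comp_contMDiffOn ((contMDiffOn_symm_of_mem_maximalAtlas he).mono Set.inter_subset_left))
      fun y hy => hy.2
  have hGinj : Function.Injective (fderiv ℝ G (e s)) :=
    (injective_mfderiv_iff hf.contMDiffAt he hs hψ hfs).1 hinj
  -- complete the derivative to an isomorphism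
  obtain ⟨Λ, hΛ⟩ : ∃ Λ : (E × F) ≃L[ℝ] E', ∀ v, Λ (v, 0) = fderiv ℝ G (e s) v :=
    exists_continuousLinearEquiv_extend hdim hGinj
  let B : F →L[ℝ] E' := (Λ : (E × F) →L[ℝ] E').comp (ContinuousLinearMap.inr ℝ E F)
  let Φ : E × F → E' := fun q => G q.1 + B q.2
  have hΦ : ContDiffOn ℝ ∞ Φ (W ×ˢ Set.univ) :=
    (hG.comp contDiff_fst.contDiffOn fun q hq => hq.1).add (B.contDiff.comp contDiff_snd).contDiffOn
  have hΛΦ : HasFDerivAt Φ (Λ : (E × F) →L[ℝ] E') (e s, 0) := by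
    have h1 : HasFDerivAt G (fderiv ℝ G (e s)) (e s, (0 : F)).1 :=
      ((hG.contDiffAt (hW.mem_nhds hesW)).differentiableAt (by simp)).hasFDerivAt
    have h2 := (h1.comp (e s, (0 : F)) hasFDerivAt_fst).add
      ((B.hasFDerivAt (x := (0 : F))).comp (e s, (0 : F)) hasFDerivAt_snd)
    have h3 : (Λ : (E × F) →L[ℝ] E') = (fderiv ℝ G (e s)).comp (ContinuousLinearMap.fst ℝ E F) +
        B.comp (ContinuousLinearMap.snd ℝ E F) := by
      ext v
      · simp [B, hΛ]
      · simp [B]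
    rw [h3]
    exact h2
  obtain ⟨T, haT, hTW, hTΦ, hTsymm⟩ := exists_openPartialHomeomorph_of_equiv
    (hW.prod isOpen_univ) (Set.mk_mem_prod hesW (Set.mem_univ _)) hΦ Λ hΛΦ
  have hTsm : ContDiffOn ℝ ∞ T T.source := (hΦ.mono hTW).congr fun y _ => hTΦ y
  -- A chart must take values in `E'`, so the straightened coordinates in `E × F` are carried back
  -- by `Λ`, which also serves as the splitting in the normal form.
  let τ : OpenPartialHomeomorph E' E' := T.symm.trans Λ.toHomeomorph.toOpenPartialHomeomorph
  let cod := ψ.trans τ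
  have hcod : cod ∈ IsManifold.maximalAtlas 𝓘(ℝ, E') ∞ M := by
    refine OpenPartialHomeomorph.mem_maximalAtlas_of_contMDiffOn _ ?_ ?_
    · have hm (y : M) (hy : y ∈ cod.source) : y ∈ ψ.source ∧ ψ y ∈ T.target := by
        simpa [cod, τ] using hy
      exact Λ.contDiff.contMDiff.comp_contMDiffOn (hTsymm.contMDiffOn.comp
        ((contMDiffOn_of_mem_maximalAtlas hψ).mono fun y hy => (hm y hy).1)
        fun y hy => (hm y hy).2)
    · have hm (z : E') (hz : z ∈ cod.target) : Λ.symm z ∈ T.source ∧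
          T (Λ.symm z) ∈ ψ.target := by
        simpa [cod, τ] using hz
      exact (contMDiffOn_symm_of_mem_maximalAtlas hψ).comp (hTsm.contMDiffOn.comp
        Λ.symm.contDiff.contMDiff.contMDiffOn fun z hz => (hm z hz).1) fun z hz => (hm z hz).2
  let D : Set S := e.source ∩ e ⁻¹' ((fun y => (y, (0 : F))) ⁻¹' T.source)
  have hD : IsOpen D := e.isOpen_inter_preimage (T.open_source.preimage (by fun_prop))
  have hdom : e.restr D ∈ IsManifold.maximalAtlas 𝓘(ℝ, E) ∞ S :=
    restr_mem_maximalAtlas (contDiffGroupoid ∞ 𝓘(ℝ, E)) he hD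
  refine .mk_of_continuousAt hf.continuous.continuousAt Λ (e.restr D) cod ?_ ?_ hdom hcod ?_
  · rw [e.restr_source, hD.interior_eq]
    exact ⟨hs, hs, haT⟩
  · have h1 : T (e s, 0) = ψ (f s) := by
      rw [hTΦ]
      simp [Φ, G, e.left_inv hs]
    have h2 : ψ (f s) ∈ T.target := h1 ▸ T.map_source haT
    simpa [cod, τ] using ⟨hfs, h2⟩
  · intro y hy
    have hy' : y ∈ e.target ∧ (y, (0 : F)) ∈ T.source := by
      have h0 : y ∈ e.target ∧ e.symm y ∈ D := by
        simpa [OpenPartialHomeomorph.restr_target, hD.interior_eq] using hy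
      refine ⟨h0.1, ?_⟩
      have h1 : (e (e.symm y), (0 : F)) ∈ T.source := h0.2.2
      rwa [e.right_inv h0.1] at h1
    have h1 : T (y, 0) = ψ (f (e.symm y)) := by
      rw [hTΦ]
      simp [Φ, G]
    change Λ (T.symm (ψ (f (e.symm y)))) = Λ (y, 0)
    rw [← h1, T.left_inv hy'.2]

end

/-! ### Homotopies fixing a point, built chart by chart -/

section

variable {X M E : Type*} [TopologicalSpace X] [TopologicalSpace M]

/-- By compactness finitely many sets `K` cover `X`; treat them one at a time. Each step keeps `P`
where it was already achieved. The finite list `T` records that each `L` is mapped into its `V`, so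
every later step still finds its support inside the chart chosen for `f₀`. -/
theorem exists_homotopicRel_of_local_steps [CompactSpace X] (Q : C(X, M) → Prop)
    (P : C(X, M) → X → Prop) (x₀ : X) (f₀ : C(X, M)) (hQ : Q f₀)
    (hloc : ∀ s : X, ∃ (K L : Set X) (V : Set M), IsClosed K ∧ K ∈ 𝓝 s ∧ IsClosed L ∧ IsOpen V ∧
      Set.MapsTo f₀ L V ∧ ∀ f : C(X, M), Q f → Set.MapsTo f L V → ∀ Z : Set X, IsClosed Z →
        (∀ z ∈ Z, P f z) → ∀ T : Finset (Set X × Set M),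
        (∀ p ∈ T, IsClosed p.1 ∧ IsOpen p.2 ∧ Set.MapsTo f p.1 p.2) →
        ∃ g : C(X, M), ContinuousMap.HomotopicRel f g {x₀} ∧ Q g ∧ (∀ z ∈ Z ∪ K, P g z) ∧
          ∀ p ∈ T, Set.MapsTo g p.1 p.2) :
    ∃ g : C(X, M), ContinuousMap.HomotopicRel f₀ g {x₀} ∧ Q g ∧ ∀ z, P g z := by
  classical
  choose K L V hK hKs hL hV hf₀ hstep using hloc
  obtain ⟨t, ht⟩ := CompactSpace.elim_nhds_subcover K hKs
  let T := t.image fun s => (L s, V s)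
  have key : ∀ t' ⊆ t, ∃ g : C(X, M), ContinuousMap.HomotopicRel f₀ g {x₀} ∧ Q g ∧
      (∀ z ∈ ⋃ s ∈ t', K s, P g z) ∧ ∀ p ∈ T, Set.MapsTo g p.1 p.2 := by
    intro t'
    induction t' using Finset.induction_on with
    | empty =>
      intro _
      refine ⟨f₀, .refl _, hQ, by simp, ?_⟩
      intro p hp
      obtain ⟨s, -, rfl⟩ := Finset.mem_image.1 hp
      exact hf₀ s
    | insert a t' _ ih =>
      intro hsub
      obtain ⟨f, hff, hQf, hPf, hTf⟩ := ih ((Finset.subset_insert a t').trans hsub)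
      obtain ⟨g, hg, hQg, hPg, hTg⟩ := hstep a f hQf
        (hTf (L a, V a) (Finset.mem_image.2 ⟨a, hsub (Finset.mem_insert_self a t'), rfl⟩))
        (⋃ s ∈ t', K s) (t'.finite_toSet.isClosed_biUnion fun s _ => hK s) hPf T (by
          intro p hp
          refine ⟨?_, ?_, hTf p hp⟩
          · obtain ⟨s, -, rfl⟩ := Finset.mem_image.1 hp
            exact hL s
          · obtain ⟨s, -, rfl⟩ := Finset.mem_image.1 hp
            exact hV s)
      refine ⟨g, hff.trans hg, hQg, fun z hz => hPg z ?_, hTg⟩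
      rw [Finset.set_biUnion_insert] at hz
      exact hz.symm
  obtain ⟨g, h1, h2, h3, -⟩ := key t subset_rfl
  exact ⟨g, h1, h2, fun z => h3 z (by rw [ht]; trivial)⟩

variable [NormedAddCommGroup E] [NormedSpace ℝ E]

/-- The homotopy is the straight line from `ψ ∘ f` to `ψ ∘ f + u` in the chart, and constant off the
support of `u`. -/
theorem exists_homotopicRel_add {f : C(X, M)} {ψ : OpenPartialHomeomorph M E} {u : X → E}
    (hu : Continuous u) (hsupp : ∀ s ∈ tsupport u, f s ∈ ψ.source)
    (htar : ∀ s ∈ tsupport u, ∀ t : I, ψ (f s) + (t : ℝ) • u s ∈ ψ.target) {x₀ : X}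
    (hx₀ : u x₀ = 0) :
    ∃ g : C(X, M), ContinuousMap.HomotopicRel f g {x₀} ∧ (∀ s, s ∉ tsupport u → g s = f s) ∧
      ∀ s, f s ∈ ψ.source → g s = ψ.symm (ψ (f s) + u s) ∧ ψ (f s) + u s ∈ ψ.target := by
  classical
  let H : I × X → M := fun q =>
    if q.2 ∈ tsupport u then ψ.symm (ψ (f q.2) + (q.1 : ℝ) • u q.2) else f q.2
  have hzero (s : X) (hs : s ∉ tsupport u) : u s = 0 := image_eq_zero_of_notMem_tsupport hs
  have hH (t : I) (s : X) (hs : f s ∈ ψ.source) :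
      H (t, s) = ψ.symm (ψ (f s) + (t : ℝ) • u s) := by
    by_cases h : s ∈ tsupport u
    · exact if_pos h
    · have : H (t, s) = f s := if_neg h
      rw [this, hzero s h, smul_zero, add_zero, ψ.left_inv hs]
  have hmem (t : I) (s : X) (hs : f s ∈ ψ.source) : ψ (f s) + (t : ℝ) • u s ∈ ψ.target := by
    by_cases h : s ∈ tsupport u
    · exact htar s h t
    · rw [hzero s h, smul_zero, add_zero]; exact ψ.map_source hs
  have hcont : Continuous H := by
    rw [continuous_iff_continuousAt]
    rintro ⟨t, s⟩
    by_cases h : s ∈ tsupport u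
    · have hs := hsupp s h
      have h1 : ContinuousAt (fun q : I × X => ψ.symm (ψ (f q.2) + (q.1 : ℝ) • u q.2)) (t, s) := by
        refine ContinuousAt.comp (f := fun q : I × X => ψ (f q.2) + (q.1 : ℝ) • u q.2)
          (ψ.continuousAt_symm (hmem t s hs)) (ContinuousAt.add ?_ (by fun_prop))
        exact ContinuousAt.comp (f := fun q : I × X => f q.2) (ψ.continuousAt hs)
          (by fun_prop)
      refine h1.congr ?_
      have h2 : ∀ᶠ q : I × X in 𝓝 (t, s), f q.2 ∈ ψ.source :=
        (f.continuous.comp continuous_snd).continuousAt.eventually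
          (ψ.open_source.mem_nhds hs)
      filter_upwards [h2] with q hq
      exact (hH q.1 q.2 hq).symm
    · have h1 : ContinuousAt (fun q : I × X => f q.2) (t, s) := by fun_prop
      refine h1.congr ?_
      have h2 : ∀ᶠ q : I × X in 𝓝 (t, s), q.2 ∉ tsupport u :=
        continuous_snd.continuousAt (x := (t, s))
          ((isClosed_tsupport u).isOpen_compl.mem_nhds (x := s) h)
      filter_upwards [h2] with q hq
      exact (if_neg hq).symm
  have hH0 (s : X) : H (0, s) = f s := by
    by_cases h : s ∈ tsupport u
    · rw [hH 0 s (hsupp s h)]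
      simp [ψ.left_inv (hsupp s h)]
    · exact if_neg h
  let g : C(X, M) := ⟨fun s => H (1, s), by fun_prop⟩
  refine ⟨g, ⟨⟨⟨⟨H, hcont⟩, hH0, fun s => rfl⟩, ?_⟩⟩, fun s hs => if_neg hs, fun s hs => ?_⟩
  · intro t y hy
    rw [Set.mem_singleton_iff.1 hy]
    change H (t, x₀) = f x₀
    by_cases h : x₀ ∈ tsupport u
    · rw [hH t x₀ (hsupp x₀ h), hx₀, smul_zero, add_zero, ψ.left_inv (hsupp x₀ h)]
    · exact if_neg h
  · have h1 := hmem 1 s hs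
    have h2 : g s = _ := hH 1 s hs
    simp only [Set.Icc.coe_one, one_smul] at h1 h2
    exact ⟨h2, h1⟩

theorem exists_homotopicRel_add_of_small [CompactSpace X] (f : C(X, M))
    (ψ : OpenPartialHomeomorph M E) {K : Set X} (hK : IsClosed K) (hKψ : Set.MapsTo f K ψ.source)
    (T : Finset (Set X × Set M))
    (hT : ∀ p ∈ T, IsClosed p.1 ∧ IsOpen p.2 ∧ Set.MapsTo f p.1 p.2) (x₀ : X) :
    ∃ ε > 0, ∀ u : X → E, Continuous u → tsupport u ⊆ K → (∀ s, ‖u s‖ < ε) → u x₀ = 0 →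
      ∃ g : C(X, M), ContinuousMap.HomotopicRel f g {x₀} ∧
        (∀ p ∈ T, Set.MapsTo g p.1 p.2) ∧ (∀ s, s ∉ tsupport u → g s = f s) ∧
        ∀ s, f s ∈ ψ.source → g s = ψ.symm (ψ (f s) + u s) ∧ ψ (f s) + u s ∈ ψ.target := by
  have hone (L : Set X) (V : Set M) (hL : IsClosed L) (hV : IsOpen V) (hLV : Set.MapsTo f L V) :
      ∀ᶠ ε : ℝ in 𝓝[>] 0, ∀ s ∈ K ∩ L, ∀ v : E, ‖v‖ < ε →
        ψ (f s) + v ∈ ψ.target ∩ ψ.symm ⁻¹' V := by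
    have hcomp : IsCompact ((fun s => ψ (f s)) '' (K ∩ L)) :=
      (hK.inter hL).isCompact.image_of_continuousOn
        (ψ.continuousOn.comp f.continuous.continuousOn fun s hs => hKψ hs.1)
    have hsub : (fun s => ψ (f s)) '' (K ∩ L) ⊆ ψ.target ∩ ψ.symm ⁻¹' V := by
      rintro _ ⟨s, hs, rfl⟩
      refine ⟨ψ.map_source (hKψ hs.1), ?_⟩
      change ψ.symm (ψ (f s)) ∈ V
      rw [ψ.left_inv (hKψ hs.1)]
      exact hLV hs.2
    -- A compact set in an open set has a uniform thickening inside it; this is the source of `ε`.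
    obtain ⟨δ, hδ, hδsub⟩ := hcomp.exists_thickening_subset_open
      (ψ.symm.isOpen_inter_preimage hV) hsub
    filter_upwards [Ioo_mem_nhdsGT hδ] with ε hε s hs v hv
    refine hδsub (Metric.mem_thickening_iff.2 ⟨_, Set.mem_image_of_mem _ hs, ?_⟩)
    rw [dist_eq_norm, add_sub_cancel_left]
    exact hv.trans hε.2
  have hall : ∀ᶠ ε : ℝ in 𝓝[>] 0, ∀ p ∈ T, ∀ s ∈ K ∩ p.1, ∀ v : E, ‖v‖ < ε →
      ψ (f s) + v ∈ ψ.target ∩ ψ.symm ⁻¹' p.2 :=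
    (Filter.eventually_all_finset T).2 fun p hp =>
      hone p.1 p.2 (hT p hp).1 (hT p hp).2.1 (hT p hp).2.2
  obtain ⟨ε, ⟨hεT, hεu⟩, hε⟩ := ((hall.and (hone Set.univ Set.univ isClosed_univ isOpen_univ
    (Set.mapsTo_univ _ _))).and self_mem_nhdsWithin).exists
  refine ⟨ε, hε, fun u hu hsupp hsmall hx₀ => ?_⟩
  obtain ⟨g, hfg, h1, h2⟩ := exists_homotopicRel_add hu (fun s hs => hKψ (hsupp hs))
    (fun s hs t => (hεu s ⟨hsupp hs, trivial⟩ _ (lt_of_le_of_lt (by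
      rw [norm_smul, Real.norm_of_nonneg t.2.1]
      exact mul_le_of_le_one_left (norm_nonneg _) t.2.2) (hsmall s))).1) hx₀
  refine ⟨g, hfg, fun p hp s hs => ?_, h1, h2⟩
  by_cases hsK : s ∈ tsupport u
  · rw [(h2 s (hKψ (hsupp hsK))).1]
    exact (hεT p hp s ⟨hsupp hsK, hs⟩ _ (hsmall s)).2
  · rw [h1 s hsK]
    exact (hT p hp).2.2 hs

end

/-! ### Perturbing by linear maps: openness and density of injective derivatives -/

section Calculus

variable {E E' : Type*} [NormedAddCommGroup E] [NormedSpace ℝ E] [NormedAddCommGroup E']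
  [NormedSpace ℝ E']

theorem fderiv_add_smul_apply_sub {G : E → E'} {r : E → ℝ} {y : E} (hG : DifferentiableAt ℝ G y)
    (hr : DifferentiableAt ℝ r y) (A : E →L[ℝ] E') (c : E) :
    fderiv ℝ (fun z => G z + r z • A (z - c)) y =
      fderiv ℝ G y + (r y • A + (fderiv ℝ r y).smulRight (A (y - c))) := by
  have h1 : HasFDerivAt (fun z => A (z - c)) A y :=
    A.hasFDerivAt.comp y ((hasFDerivAt_id y).sub_const c)
  exact (hG.hasFDerivAt.add (hr.hasFDerivAt.smul h1)).fderiv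

/-- Injectivity is an open condition and the derivative depends continuously on `(A, y)`, so on the
compact set `C` a small `A` cannot destroy it. -/
theorem eventually_forall_injective_fderiv [FiniteDimensional ℝ E] {G : E → E'} {r : E → ℝ}
    {W C : Set E} (hW : IsOpen W) (hG : ContDiffOn ℝ ∞ G W) (hr : ContDiffOn ℝ ∞ r W)
    (hC : IsCompact C) (hCW : C ⊆ W) (hinj : ∀ y ∈ C, Function.Injective (fderiv ℝ G y)) (c : E) :
    ∀ᶠ A : E →L[ℝ] E' in 𝓝 0, ∀ y ∈ C,
      Function.Injective (fderiv ℝ (fun z => G z + r z • A (z - c)) y) := by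
  let D : (E →L[ℝ] E') × E → E →L[ℝ] E' := fun q =>
    fderiv ℝ G q.2 + (r q.2 • q.1 + (fderiv ℝ r q.2).smulRight (q.1 (q.2 - c)))
  have h : ∀ᶠ A : E →L[ℝ] E' in 𝓝 0, ∀ y ∈ C, Function.Injective (D (A, y)) := by
    refine hC.eventually_forall_of_forall_eventually fun y hy => ?_
    have hcont : ContinuousAt D (0, y) := by
      have hyW := hW.mem_nhds (hCW hy)
      have h1 : ContinuousAt (fderiv ℝ G) y :=
        (hG.continuousOn_fderiv_of_isOpen hW (by simp)).continuousAt hyW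
      have h2 : ContinuousAt (fderiv ℝ r) y :=
        (hr.continuousOn_fderiv_of_isOpen hW (by simp)).continuousAt hyW
      have h3 : ContinuousAt r y := hr.continuousOn.continuousAt hyW
      have hs : ContinuousAt (fun q : (E →L[ℝ] E') × E => q.2) (0, y) := continuousAt_snd
      have h4 : ContinuousAt (fun q : (E →L[ℝ] E') × E => q.1 (q.2 - c)) (0, y) := by fun_prop
      have h5 : ContinuousAt (fun q : (E →L[ℝ] E') × E => fderiv ℝ r q.2) (0, y) :=
        ContinuousAt.comp (f := fun q : (E →L[ℝ] E') × E => q.2) h2 hs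
      have h6 : ContinuousAt (fun q : (E →L[ℝ] E') × E => fderiv ℝ G q.2) (0, y) :=
        ContinuousAt.comp (f := fun q : (E →L[ℝ] E') × E => q.2) h1 hs
      have h7 : ContinuousAt (fun q : (E →L[ℝ] E') × E => r q.2) (0, y) :=
        ContinuousAt.comp (f := fun q : (E →L[ℝ] E') × E => q.2) h3 hs
      have h8 : ContinuousAt (fun q : (E →L[ℝ] E') × E =>
          (fderiv ℝ r q.2).smulRight (q.1 (q.2 - c))) (0, y) := by
        exact isBoundedBilinearMap_smulRight.continuous.continuousAt.comp (h5.prodMk h4)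
      exact h6.add ((h7.smul continuousAt_fst).add h8)
    refine hcont.eventually (ContinuousLinearMap.isOpen_injective.mem_nhds ?_)
    simpa [D] using hinj y hy
  filter_upwards [h] with A hA y hy
  have hyW := hW.mem_nhds (hCW hy)
  rw [fderiv_add_smul_apply_sub ((hG.contDiffAt hyW).differentiableAt (by simp))
    ((hr.contDiffAt hyW).differentiableAt (by simp))]
  exact hA y hy

theorem dimH_image_smulRight_sub_le [FiniteDimensional ℝ E] [FiniteDimensional ℝ E'] {G : E → E'}
    {W : Set E} (hW : IsOpen W)
    (hWc : Convex ℝ W) (hG : ContDiffOn ℝ ∞ G W) {l : ℝ → E →L[ℝ] ℝ} (hl : ContDiff ℝ 1 l) :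
    dimH ((fun q : E × ℝ × E' => (l q.2.1).smulRight q.2.2 - fderiv ℝ G q.1) ''
      (W ×ˢ Set.univ)) ≤ (Module.finrank ℝ E + (1 + Module.finrank ℝ E') : ℕ) := by
  have h : ContDiffOn ℝ 1 (fun q : E × ℝ × E' => (l q.2.1).smulRight q.2.2 - fderiv ℝ G q.1)
      (W ×ˢ Set.univ) := by
    refine ContDiffOn.sub ?_ ?_
    · apply ContDiff.contDiffOn
      exact ContDiff.smulRight (hl.comp (by fun_prop)) (by fun_prop)
    · exact (hG.fderiv_of_isOpen hW (m := 1) (by norm_cast)).comp contDiff_fst.contDiffOn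
        fun q hq => hq.1
  refine (h.dimH_image_le (hWc.prod convex_univ) subset_rfl).trans ?_
  refine (dimH_mono (Set.subset_univ _)).trans ?_
  rw [Real.dimH_univ_eq_finrank]
  simp

/-- A bad `A` is a map of rank at most 1 minus a derivative of `G`. Such differences are smoothly
parametrized by `2 + 1 + 4 = 7` variables, so they have Hausdorff dimension at most 7 in an
8-dimensional space, and their complement is dense. -/
theorem dense_forall_injective_fderiv_add {G : EuclideanSpace ℝ (Fin 2) → EuclideanSpace ℝ (Fin 4)}
    {W : Set (EuclideanSpace ℝ (Fin 2))} (hW : IsOpen W) (hWc : Convex ℝ W)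
    (hG : ContDiffOn ℝ ∞ G W) :
    Dense {A : EuclideanSpace ℝ (Fin 2) →L[ℝ] EuclideanSpace ℝ (Fin 4) |
      ∀ y ∈ W, Function.Injective (fderiv ℝ G y + A)} := by
  let π (i : Fin 2) : EuclideanSpace ℝ (Fin 2) →L[ℝ] ℝ := EuclideanSpace.proj i
  -- A noninjective map kills either some $(1,a)$, and then factors through `l₁ a`, or $(0,1)$, and
  -- then factors through `l₂`.
  let l₁ : ℝ → EuclideanSpace ℝ (Fin 2) →L[ℝ] ℝ := fun a => π 1 - a • π 0
  let l₂ : ℝ → EuclideanSpace ℝ (Fin 2) →L[ℝ] ℝ := fun _ => π 0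
  let B (l : ℝ → EuclideanSpace ℝ (Fin 2) →L[ℝ] ℝ) :
      Set (EuclideanSpace ℝ (Fin 2) →L[ℝ] EuclideanSpace ℝ (Fin 4)) :=
    (fun q : EuclideanSpace ℝ (Fin 2) × ℝ × EuclideanSpace ℝ (Fin 4) =>
      (l q.2.1).smulRight q.2.2 - fderiv ℝ G q.1) '' (W ×ˢ Set.univ)
  have hdim : dimH (B l₁ ∪ B l₂) < Module.finrank ℝ
      (EuclideanSpace ℝ (Fin 2) →L[ℝ] EuclideanSpace ℝ (Fin 4)) := by
    have h8 : Module.finrank ℝ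
        (EuclideanSpace ℝ (Fin 2) →L[ℝ] EuclideanSpace ℝ (Fin 4)) = 8 := by
      rw [← (LinearMap.toContinuousLinearMap (𝕜 := ℝ) (E := EuclideanSpace ℝ (Fin 2))
        (F' := EuclideanSpace ℝ (Fin 4))).finrank_eq, Module.finrank_linearMap]
      simp
    have h7 {l : ℝ → EuclideanSpace ℝ (Fin 2) →L[ℝ] ℝ} (hl : ContDiff ℝ 1 l) :
        dimH (B l) ≤ 7 := by
      refine (dimH_image_smulRight_sub_le hW hWc hG hl).trans ?_
      simp
    rw [dimH_union, h8]
    refine lt_of_le_of_lt (max_le (h7 ?_) (h7 ?_)) (by norm_num : (7 : ENNReal) < (8 : ℕ))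
    · fun_prop
    · fun_prop
  refine (dense_compl_of_dimH_lt_finrank hdim).mono fun A hA y hy => ?_
  by_contra hninj
  apply hA
  obtain ⟨v, hv, hv0⟩ : ∃ v, (fderiv ℝ G y + A) v = 0 ∧ v ≠ 0 := by
    rw [injective_iff_map_eq_zero] at hninj
    push Not at hninj
    exact hninj
  obtain ⟨D, hD⟩ : ∃ D, D = fderiv ℝ G y + A := ⟨_, rfl⟩
  rw [← hD] at hv
  have hA' : A = D - fderiv ℝ G y := by rw [hD]; abel
  let b (i : Fin 2) : EuclideanSpace ℝ (Fin 2) := EuclideanSpace.single i 1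
  have hexp (w : EuclideanSpace ℝ (Fin 2)) : w = w 0 • b 0 + w 1 • b 1 := by
    ext i; fin_cases i <;> simp [b]
  have hDw (w : EuclideanSpace ℝ (Fin 2)) : D w = w 0 • D (b 0) + w 1 • D (b 1) := by
    conv_lhs => rw [hexp w]
    rw [map_add, map_smul, map_smul]
  by_cases h0 : v 0 = 0
  · right
    refine ⟨(y, 0, D (b 0)), ⟨hy, trivial⟩, ?_⟩
    have h1 : v 1 ≠ 0 := by
      intro h1
      apply hv0
      rw [hexp v, h0, h1]; simp
    have h2 : D (b 1) = 0 := by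
      have := hDw v
      rw [hv, h0, zero_smul, zero_add] at this
      exact (smul_eq_zero.1 this.symm).resolve_left h1
    have hsr : (l₂ 0).smulRight (D (b 0)) = D := by
      ext1 w
      rw [hDw w, h2]
      simp [l₂, π]
    simp only [hA', hsr]
  · left
    refine ⟨(y, v 1 / v 0, D (b 1)), ⟨hy, trivial⟩, ?_⟩
    have h2 : D (b 0) = -(v 1 / v 0) • D (b 1) := by
      have := hDw v
      rw [hv] at this
      have h3 : v 0 • D (b 0) = -(v 1 • D (b 1)) := eq_neg_of_add_eq_zero_left this.symm
      calc D (b 0) = (v 0)⁻¹ • (v 0 • D (b 0)) := by rw [smul_smul, inv_mul_cancel₀ h0, one_smul]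
        _ = _ := by rw [h3, smul_neg, smul_smul, neg_smul, div_eq_inv_mul]
    have hsr : (l₁ (v 1 / v 0)).smulRight (D (b 1)) = D := by
      ext1 w
      rw [hDw w, h2, smul_smul, ← add_smul]
      change (w 1 - v 1 / v 0 * w 0) • D (b 1) = _
      congr 1
      ring
    simp only [hA', hsr]

end Calculus

/-! ### Smoothing and making a map of a surface immersive -/

section

variable {E S : Type*} [NormedAddCommGroup E] [NormedSpace ℝ E] [TopologicalSpace S]
  [ChartedSpace E S]

theorem SmoothBumpFunction.exists_isClosed_nhd [CompactSpace S] [T2Space S]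
    {s₀ : S} (ρ : SmoothBumpFunction 𝓘(ℝ, E) s₀) :
    ∃ K : Set S, IsClosed K ∧ K ∈ 𝓝 s₀ ∧ ∀ s ∈ K, s ∈ (chartAt E s₀).source ∧
      chartAt E s₀ s ∈ Metric.ball (chartAt E s₀ s₀) ρ.rIn := by
  have h : (chartAt E s₀).source ∩ chartAt E s₀ ⁻¹' Metric.ball (chartAt E s₀ s₀) ρ.rIn ∈ 𝓝 s₀ :=
    ((chartAt E s₀).isOpen_inter_preimage Metric.isOpen_ball).mem_nhds
      ⟨mem_chart_source E s₀, Metric.mem_ball_self ρ.rIn_pos⟩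
  obtain ⟨K, ⟨hK, hKc⟩, hKsub⟩ := (closed_nhds_basis s₀).mem_iff.1 h
  exact ⟨K, hKc, hK, fun s hs => hKsub hs⟩

variable [FiniteDimensional ℝ E]

theorem SmoothBumpFunction.eventually_eq_one {s₀ : S} (ρ : SmoothBumpFunction 𝓘(ℝ, E) s₀) {s : S}
    (hs : s ∈ (chartAt E s₀).source)
    (hd : chartAt E s₀ s ∈ Metric.ball (chartAt E s₀ s₀) ρ.rIn) : ∀ᶠ z in 𝓝 s, ρ z = 1 :=
  ρ.eventuallyEq_one_of_dist_lt hs (by simpa using hd)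

theorem SmoothBumpFunction.exists_tsupport_subset [CompactSpace S] [T2Space S]
    {s₀ : S} {U : Set S} (hU : U ∈ 𝓝 s₀) :
    ∃ ρ : SmoothBumpFunction 𝓘(ℝ, E) s₀, tsupport ρ ⊆ U := by
  have hb : (𝓝 s₀).HasBasis (fun _ => True)
      fun ρ : SmoothBumpFunction 𝓘(ℝ, E) s₀ => tsupport ρ :=
    SmoothBumpFunction.nhds_basis_tsupport s₀
  obtain ⟨ρ, -, hρ⟩ := hb.mem_iff.1 hU
  exact ⟨ρ, hρ⟩

end

section

variable {E E' S M : Type*} [NormedAddCommGroup E] [NormedSpace ℝ E] [FiniteDimensional ℝ E]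
  [NormedAddCommGroup E'] [NormedSpace ℝ E'] [FiniteDimensional ℝ E'] [TopologicalSpace S]
  [CompactSpace S] [T2Space S] [ChartedSpace E S] [IsManifold 𝓘(ℝ, E) ∞ S]
  [TopologicalSpace M] [ChartedSpace E' M]

theorem exists_homotopicRel_contMDiffAt_step (f : C(S, M)) (x₀ : S) {s₀ : S}
    (ρ : SmoothBumpFunction 𝓘(ℝ, E) s₀) {ψ : OpenPartialHomeomorph M E'}
    (hψ : ψ ∈ IsManifold.maximalAtlas 𝓘(ℝ, E') ∞ M) (hρψ : Set.MapsTo f (tsupport ρ) ψ.source)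
    (T : Finset (Set S × Set M))
    (hT : ∀ p ∈ T, IsClosed p.1 ∧ IsOpen p.2 ∧ Set.MapsTo f p.1 p.2) :
    ∃ g : C(S, M), ContinuousMap.HomotopicRel f g {x₀} ∧ (∀ p ∈ T, Set.MapsTo g p.1 p.2) ∧
      ∀ s, ContMDiffAt 𝓘(ℝ, E) 𝓘(ℝ, E') ∞ f s ∨ (∀ᶠ z in 𝓝 s, ρ z = 1) →
        ContMDiffAt 𝓘(ℝ, E) 𝓘(ℝ, E') ∞ g s := by
  obtain ⟨ε, hε, H⟩ := exists_homotopicRel_add_of_small f ψ (isClosed_tsupport ρ) hρψ T hT x₀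
  let w₀ : C(tsupport ρ, E') := ⟨fun s => ψ (f s), continuousOn_iff_continuous_domRestrict.1
    (ψ.continuousOn.comp f.continuous.continuousOn hρψ)⟩
  -- Tietze extension: `ψ ∘ f` makes sense only where `f` meets the chart, while the approximation
  -- theorem needs a map on all of `S`.
  obtain ⟨w, hw⟩ := w₀.exists_restrict_eq (isClosed_tsupport ρ)
  have hwψ (s : S) (hs : s ∈ tsupport ρ) : w s = ψ (f s) := congrArg (· ⟨s, hs⟩) hw
  obtain ⟨p, hp, -⟩ := w.continuous.exists_contMDiff_approx 𝓘(ℝ, E) ⊤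
    (continuous_const (y := ε / 2)) (fun _ => half_pos hε)
  -- The translation makes `q` and `w` agree at `x₀`, so the homotopy fixes `x₀`. It at most doubles
  -- the error, whence `ε / 2` above.
  let q : S → E' := fun s => p s + (w x₀ - p x₀)
  have hq : ContMDiff 𝓘(ℝ, E) 𝓘(ℝ, E') ∞ q := p.contMDiff.add contMDiff_const
  have hqw (s : S) : ‖q s - w s‖ < ε := by
    have h1 := hp s
    have h2 := hp x₀
    rw [dist_eq_norm] at h1 h2
    calc ‖q s - w s‖ = ‖(p s - w s) - (p x₀ - w x₀)‖ := by congr 1; simp only [q]; abel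
      _ ≤ ‖p s - w s‖ + ‖p x₀ - w x₀‖ := norm_sub_le _ _
      _ < ε := by linarith
  -- Adding `u` interpolates between `ψ ∘ f` and `q`: the result is smooth where `ρ` is locally 1,
  -- and stays smooth where `f` was.
  let u : S → E' := fun s => ρ s • (q s - w s)
  have hu : Continuous u := ρ.continuous.smul (hq.continuous.sub w.continuous)
  have huψ (s : S) : u s = ρ s • (q s - ψ (f s)) := by
    by_cases hs : s ∈ tsupport ρ
    · simp only [u, hwψ s hs]
    · simp only [u, image_eq_zero_of_notMem_tsupport hs, zero_smul]
  have husupp : tsupport u ⊆ tsupport ρ := tsupport_smul_subset_left _ _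
  obtain ⟨g, hfg, hgT, hgf, hgψ⟩ := H u hu husupp (fun s => by
    rw [norm_smul, Real.norm_of_nonneg ρ.nonneg]
    exact lt_of_le_of_lt (mul_le_of_le_one_left (norm_nonneg _) ρ.le_one) (hqw s))
    (by simp [u, q])
  refine ⟨g, hfg, hgT, fun s hs => ?_⟩
  by_cases hfs : f s ∈ ψ.source
  · have hev : ∀ᶠ z in 𝓝 s, f z ∈ ψ.source :=
      f.continuous.continuousAt (ψ.open_source.mem_nhds hfs)
    have hsum : ContMDiffAt 𝓘(ℝ, E) 𝓘(ℝ, E') ∞ (fun z => ψ (f z) + u z) s := by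
      rcases hs with hs | hs
      · have h1 : ContMDiffAt 𝓘(ℝ, E) 𝓘(ℝ, E') ∞ (fun z => ψ (f z)) s :=
          ((contMDiffOn_of_mem_maximalAtlas hψ).contMDiffAt (ψ.open_source.mem_nhds hfs)).comp s hs
        simp only [huψ]
        exact h1.add (ρ.contMDiffAt.smul (hq.contMDiffAt.sub h1))
      · refine hq.contMDiffAt.congr_of_eventuallyEq ?_
        filter_upwards [hs] with z hz
        rw [huψ, hz, one_smul, add_sub_cancel]
    have h2 := ((contMDiffOn_symm_of_mem_maximalAtlas hψ).contMDiffAt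
      (ψ.open_target.mem_nhds (hgψ s hfs).2)).comp (f := fun z => ψ (f z) + u z) s hsum
    refine h2.congr_of_eventuallyEq ?_
    filter_upwards [hev] with z hz
    exact (hgψ z hz).1
  · have hsu : s ∉ tsupport ρ := fun h => hfs (hρψ h)
    have hfg' : g =ᶠ[𝓝 s] f := by
      filter_upwards [(isClosed_tsupport ρ).isOpen_compl.mem_nhds hsu] with z hz
      exact hgf z fun h => hz (husupp h)
    rcases hs with hs | hs
    · exact hs.congr_of_eventuallyEq hfg'
    · exact absurd (subset_tsupport _ (by
        rw [Function.mem_support, hs.self_of_nhds]; exact one_ne_zero)) hsu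

variable [IsManifold 𝓘(ℝ, E') ∞ M]

theorem exists_homotopicRel_contMDiff (f₀ : C(S, M)) (x₀ : S) :
    ∃ g : C(S, M), ContinuousMap.HomotopicRel f₀ g {x₀} ∧ ContMDiff 𝓘(ℝ, E) 𝓘(ℝ, E') ∞ g := by
  obtain ⟨g, hfg, -, hg⟩ := exists_homotopicRel_of_local_steps (fun _ => True)
    (fun g s => ContMDiffAt 𝓘(ℝ, E) 𝓘(ℝ, E') ∞ g s) x₀ f₀ trivial fun s₀ => by
      let ψ := chartAt E' (f₀ s₀)
      obtain ⟨ρ, hρ⟩ := SmoothBumpFunction.exists_tsupport_subset (E := E) (s₀ := s₀)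
        (f₀.continuous.continuousAt (ψ.open_source.mem_nhds (mem_chart_source E' (f₀ s₀))))
      obtain ⟨K, hK, hKs, hKρ⟩ := ρ.exists_isClosed_nhd
      refine ⟨K, tsupport ρ, ψ.source, hK, hKs, isClosed_tsupport _, ψ.open_source, hρ, ?_⟩
      intro f _ hf Z _ hZ T hT
      obtain ⟨g, h1, h2, h3⟩ := exists_homotopicRel_contMDiffAt_step f x₀ ρ
        (IsManifold.chart_mem_maximalAtlas (f₀ s₀)) hf T hT
      refine ⟨g, h1, trivial, fun z hz => h3 z ?_, h2⟩
      exact hz.imp (hZ z) fun hz => ρ.eventually_eq_one (hKρ z hz).1 (hKρ z hz).2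
  exact ⟨g, hfg, hg⟩

end

section

variable {S M : Type*} [TopologicalSpace S] [CompactSpace S] [T2Space S]
  [ChartedSpace (EuclideanSpace ℝ (Fin 2)) S] [IsManifold (𝓡 2) ∞ S]
  [TopologicalSpace M] [ChartedSpace (EuclideanSpace ℝ (Fin 4)) M] [IsManifold (𝓡 4) ∞ M]

theorem exists_homotopicRel_injective_mfderiv_step (f : C(S, M)) (hf : ContMDiff (𝓡 2) (𝓡 4) ∞ f)
    (x₀ : S) {s₀ : S} (ρ : SmoothBumpFunction (𝓡 2) s₀)
    {ψ : OpenPartialHomeomorph M (EuclideanSpace ℝ (Fin 4))}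
    (hψ : ψ ∈ IsManifold.maximalAtlas (𝓡 4) ∞ M) (hρψ : Set.MapsTo f (tsupport ρ) ψ.source)
    {Z : Set S} (hZ : IsClosed Z) (hinj : ∀ z ∈ Z, Function.Injective (mfderiv (𝓡 2) (𝓡 4) f z))
    (T : Finset (Set S × Set M))
    (hT : ∀ p ∈ T, IsClosed p.1 ∧ IsOpen p.2 ∧ Set.MapsTo f p.1 p.2) :
    ∃ g : C(S, M), ContinuousMap.HomotopicRel f g {x₀} ∧ ContMDiff (𝓡 2) (𝓡 4) ∞ g ∧
      (∀ p ∈ T, Set.MapsTo g p.1 p.2) ∧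
      ∀ s, s ∈ Z ∨ (s ∈ (chartAt (EuclideanSpace ℝ (Fin 2)) s₀).source ∧
          chartAt (EuclideanSpace ℝ (Fin 2)) s₀ s ∈
            Metric.ball (chartAt (EuclideanSpace ℝ (Fin 2)) s₀ s₀) ρ.rIn) →
        Function.Injective (mfderiv (𝓡 2) (𝓡 4) g s) := by
  let e := chartAt (EuclideanSpace ℝ (Fin 2)) s₀
  have he : e ∈ IsManifold.maximalAtlas (𝓡 2) ∞ S := IsManifold.chart_mem_maximalAtlas s₀
  obtain ⟨ε, hε, H⟩ := exists_homotopicRel_add_of_small f ψ (isClosed_tsupport ρ) hρψ T hT x₀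
  have hρe : tsupport ρ ⊆ e.source := ρ.tsupport_subset_chartAt_source
  -- the local expressions of `f` and `ρ`
  let G : EuclideanSpace ℝ (Fin 2) → EuclideanSpace ℝ (Fin 4) := ψ ∘ f ∘ e.symm
  let r : EuclideanSpace ℝ (Fin 2) → ℝ := ρ ∘ e.symm
  -- Centring at `e x₀` makes the perturbation vanish at `x₀`. If `x₀` lies outside the chart this
  -- is a default value, which does no harm.
  let c := e x₀
  let W : Set (EuclideanSpace ℝ (Fin 2)) := e.target ∩ e.symm ⁻¹' (f ⁻¹' ψ.source)
  have hW : IsOpen W := e.symm.isOpen_inter_preimage (ψ.open_source.preimage f.continuous)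
  have hG : ContDiffOn ℝ ∞ G W := by
    rw [← contMDiffOn_iff_contDiffOn]
    exact (contMDiffOn_of_mem_maximalAtlas hψ).comp
      (hf.comp_contMDiffOn ((contMDiffOn_symm_of_mem_maximalAtlas he).mono Set.inter_subset_left))
      fun y hy => hy.2
  have hr : ContDiffOn ℝ ∞ r W := by
    rw [← contMDiffOn_iff_contDiffOn]
    exact ρ.contMDiff.comp_contMDiffOn
      ((contMDiffOn_symm_of_mem_maximalAtlas he).mono Set.inter_subset_left)
  let C := e '' (Z ∩ tsupport ρ)
  have hC : IsCompact C := (hZ.inter (isClosed_tsupport ρ)).isCompact.image_of_continuousOn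
    (e.continuousOn.mono fun s hs => hρe hs.2)
  have hmemW (s : S) (hs : s ∈ e.source) (hfs : f s ∈ ψ.source) : e s ∈ W :=
    ⟨e.map_source hs, by rw [Set.mem_preimage, e.left_inv hs]; exact hfs⟩
  have hCW : C ⊆ W := by
    rintro _ ⟨s, hs, rfl⟩
    exact hmemW s (hρe hs.2) (hρψ hs.2)
  have hCinj : ∀ y ∈ C, Function.Injective (fderiv ℝ G y) := by
    rintro _ ⟨s, hs, rfl⟩
    exact (injective_mfderiv_iff hf.contMDiffAt he (hρe hs.2) hψ (hρψ hs.2)).1 (hinj s hs.1)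
  let W₁ := Metric.ball (e s₀) ρ.rIn
  have hW₁ (y) (hy : y ∈ W₁) : y ∈ e.target ∧ ρ (e.symm y) = 1 := by
    have h1 : y ∈ e.target := by
      have := ρ.ball_subset
      simp only [mfld_simps] at this
      exact this (Metric.ball_subset_ball ρ.rIn_lt_rOut.le hy)
    refine ⟨h1, (ρ.eventually_eq_one (e.map_target h1) ?_).self_of_nhds⟩
    rwa [e.right_inv h1]
  have hW₁W : W₁ ⊆ W := fun y hy => by
    obtain ⟨h1, h2⟩ := hW₁ y hy
    refine ⟨h1, hρψ (subset_tsupport _ ?_)⟩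
    rw [Function.mem_support, h2]; exact one_ne_zero
  -- choose the perturbation
  obtain ⟨R, hR⟩ : ∃ R, ∀ s ∈ tsupport ρ, ‖e s - c‖ ≤ R :=
    (isClosed_tsupport ρ).isCompact.exists_bound_of_continuousOn
      ((e.continuousOn.mono hρe).sub continuousOn_const)
  have hev : ∀ᶠ A : EuclideanSpace ℝ (Fin 2) →L[ℝ] EuclideanSpace ℝ (Fin 4) in 𝓝 0,
      ‖A‖ * |R| < ε := by
    refine ContinuousAt.eventually_lt (by fun_prop) continuousAt_const ?_
    simpa using hε
  -- Density makes the derivative injective on the new ball, where `ρ = 1` and the perturbation adds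
  -- exactly `A`; smallness preserves injectivity on the old set `C` and keeps the homotopy within
  -- the chart.
  obtain ⟨A, hAW₁, hAε, hAC⟩ := (dense_forall_injective_fderiv_add Metric.isOpen_ball
    (convex_ball _ _) (hG.mono hW₁W)).inter_nhds_nonempty
    (hev.and (eventually_forall_injective_fderiv hW hG hr hC hCW hCinj c))
  let u : S → EuclideanSpace ℝ (Fin 4) := fun s => ρ s • A (e s - c)
  have hu : ContMDiff (𝓡 2) (𝓡 4) ∞ u := ρ.contMDiff_smul
    ((A.contDiff.comp (contDiff_id.sub contDiff_const)).contMDiff.comp_contMDiffOn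
      (contMDiffOn_of_mem_maximalAtlas he))
  have husupp : tsupport u ⊆ tsupport ρ := tsupport_smul_subset_left _ _
  obtain ⟨g, hfg, hgT, hgf, hgψ⟩ := H u hu.continuous husupp (fun s => by
    by_cases hs : s ∈ tsupport ρ
    · rw [norm_smul, Real.norm_of_nonneg ρ.nonneg]
      refine lt_of_le_of_lt (mul_le_of_le_one_left (norm_nonneg _) ρ.le_one) ?_
      refine lt_of_le_of_lt (A.le_opNorm _) (lt_of_le_of_lt ?_ hAε)
      gcongr
      exact (hR s hs).trans (le_abs_self R)
    · simpa only [u, image_eq_zero_of_notMem_tsupport hs, zero_smul, norm_zero] using hε)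
    (by simp [u, c])
  have hgeq (s : S) (hfs : f s ∈ ψ.source) :
      g =ᶠ[𝓝 s] fun z => ψ.symm (ψ (f z) + u z) := by
    filter_upwards [f.continuous.continuousAt (ψ.open_source.mem_nhds hfs)] with z hz
    exact (hgψ z hz).1
  have hgf' (s : S) (hs : s ∉ tsupport ρ) : g =ᶠ[𝓝 s] f := by
    filter_upwards [(isClosed_tsupport ρ).isOpen_compl.mem_nhds hs] with z hz
    exact hgf z fun h => hz (husupp h)
  have hg : ContMDiff (𝓡 2) (𝓡 4) ∞ g := by
    intro s
    by_cases hfs : f s ∈ ψ.source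
    · have h1 : ContMDiffAt (𝓡 2) (𝓡 4) ∞ (fun z => ψ (f z)) s :=
        ((contMDiffOn_of_mem_maximalAtlas hψ).contMDiffAt (ψ.open_source.mem_nhds hfs)).comp s
          hf.contMDiffAt
      exact (((contMDiffOn_symm_of_mem_maximalAtlas hψ).contMDiffAt
        (ψ.open_target.mem_nhds (hgψ s hfs).2)).comp (f := fun z => ψ (f z) + u z) s
          (h1.add hu.contMDiffAt)).congr_of_eventuallyEq (hgeq s hfs)
    · exact hf.contMDiffAt.congr_of_eventuallyEq (hgf' s fun h => hfs (hρψ h))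
  have hgiff (s : S) (hs : s ∈ tsupport ρ) : Function.Injective (mfderiv (𝓡 2) (𝓡 4) g s) ↔
      Function.Injective (fderiv ℝ (fun z => G z + r z • A (z - c)) (e s)) := by
    have hfs := hρψ hs
    have hgs : g s ∈ ψ.source := by
      rw [(hgψ s hfs).1]; exact ψ.map_target (hgψ s hfs).2
    rw [injective_mfderiv_iff hg.contMDiffAt he (hρe hs) hψ hgs]
    have hev : (ψ ∘ g ∘ e.symm) =ᶠ[𝓝 (e s)] fun z => G z + r z • A (z - c) := by
      filter_upwards [hW.mem_nhds (hmemW s (hρe hs) hfs)] with z hz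
      have h1 := hgψ (e.symm z) hz.2
      change ψ (g (e.symm z)) = _
      rw [h1.1, ψ.right_inv h1.2]
      simp only [u, G, r, Function.comp_apply, e.right_inv hz.1]
    rw [hev.fderiv_eq]
  refine ⟨g, hfg, hg, hgT, fun s hs => ?_⟩
  by_cases hsρ : s ∈ tsupport ρ
  · rw [hgiff s hsρ]
    rcases hs with hs | ⟨-, hs⟩
    · exact hAC _ ⟨s, ⟨hs, hsρ⟩, rfl⟩
    · have hsW := hW.mem_nhds (hW₁W hs)
      have hr1 : r =ᶠ[𝓝 (e s)] fun _ => 1 := by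
        filter_upwards [Metric.isOpen_ball.mem_nhds hs] with y hy
        exact (hW₁ y hy).2
      rw [fderiv_add_smul_apply_sub ((hG.contDiffAt hsW).differentiableAt (by simp))
        ((hr.contDiffAt hsW).differentiableAt (by simp)), hr1.fderiv_eq, hr1.self_of_nhds]
      simpa using hAW₁ _ hs
  · rcases hs with hs | hs
    · rw [(hgf' s hsρ).mfderiv_eq]
      exact hinj s hs
    · refine absurd (subset_tsupport _ ?_) hsρ
      rw [Function.mem_support, (ρ.eventually_eq_one hs.1 hs.2).self_of_nhds]
      exact one_ne_zero

theorem exists_homotopicRel_contMDiff_injective_mfderiv (f : C(S, M)) (x₀ : S) :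
    ∃ g : C(S, M), ContinuousMap.HomotopicRel f g {x₀} ∧ ContMDiff (𝓡 2) (𝓡 4) ∞ g ∧
      ∀ s, Function.Injective (mfderiv (𝓡 2) (𝓡 4) g s) := by
  obtain ⟨f₁, hff₁, hf₁⟩ := exists_homotopicRel_contMDiff (E := EuclideanSpace ℝ (Fin 2))
    (E' := EuclideanSpace ℝ (Fin 4)) f x₀
  obtain ⟨g, hfg, hg, hginj⟩ := exists_homotopicRel_of_local_steps
    (fun g => ContMDiff (𝓡 2) (𝓡 4) ∞ g)
    (fun g s => Function.Injective (mfderiv (𝓡 2) (𝓡 4) g s)) x₀ f₁ hf₁ fun s₀ => by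
      let ψ := chartAt (EuclideanSpace ℝ (Fin 4)) (f₁ s₀)
      obtain ⟨ρ, hρ⟩ := SmoothBumpFunction.exists_tsupport_subset
        (E := EuclideanSpace ℝ (Fin 2)) (s₀ := s₀) (f₁.continuous.continuousAt (ψ.open_source.mem_nhds (mem_chart_source _ (f₁ s₀))))
      obtain ⟨K, hK, hKs, hKρ⟩ := ρ.exists_isClosed_nhd
      refine ⟨K, tsupport ρ, ψ.source, hK, hKs, isClosed_tsupport _, ψ.open_source, hρ, ?_⟩
      intro f hfs hf Z hZ hZi T hT
      obtain ⟨g, h1, h2, h3, h4⟩ := exists_homotopicRel_injective_mfderiv_step f hfs x₀ ρ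
        (IsManifold.chart_mem_maximalAtlas (f₁ s₀)) hf hZ hZi T hT
      exact ⟨g, h1, h2, fun z hz => h4 z (hz.imp id (hKρ z)), h3⟩
  exact ⟨g, hff₁.trans hfg, hg, hginj⟩

end

/-! ### Representing a class by an immersion, and conclusion -/

theorem exists_sphere_immersion {M : Type*} [TopologicalSpace M]
    [ChartedSpace (EuclideanSpace ℝ (Fin 4)) M] [IsManifold (𝓡 4) ∞ M] {x : M}
    (g : GenLoop (Fin 2) M x) : ∃ h : C(Sphere2, M), h northPole = x ∧
      (h.comp collapse).HomotopicRel g.1 (Cube.boundary (Fin 2)) ∧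
      Manifold.IsImmersionOfComplement (EuclideanSpace ℝ (Fin 2)) (𝓡 2) (𝓡 4) ∞ h := by
  obtain ⟨f, hf⟩ := exists_comp_collapse_eq g.1 x g.2
  obtain ⟨h, hfh, hh, hinj⟩ := exists_homotopicRel_contMDiff_injective_mfderiv f northPole
  have h0 : (0 : Fin 2 → I) ∈ Cube.boundary (Fin 2) := ⟨0, Or.inl rfl⟩
  refine ⟨h, ?_, ?_, fun s => isImmersionAtOfComplement_of_injective (by simp) hh (hinj s)⟩
  · rw [← hfh.fst_eq_snd (Set.mem_singleton _), ← collapse_boundary 0 h0]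
    exact (DFunLike.congr_fun hf 0).trans (g.2 0 h0)
  -- `collapse` sends the boundary to the north pole, which the homotopy fixes, so precomposition
  -- turns it into a homotopy relative to the boundary.
  · obtain ⟨H⟩ := hfh.symm
    rw [← hf]
    refine ⟨⟨⟨⟨fun q => H (q.1, collapse q.2), by fun_prop⟩, fun s => H.apply_zero _,
      fun s => H.apply_one _⟩, fun t s hs => ?_⟩⟩
    exact H.eq_fst t (collapse_boundary s hs)

end

theorem lemma3p1 {M : Type u} [TopologicalSpace M] [T2Space M] [SecondCountableTopology M]
    [ConnectedSpace M] [ChartedSpace (EuclideanSpace ℝ (Fin 4)) M] [IsManifold (𝓡 4) ∞ M]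
    (x : M) [Group.ResiduallyFinite (FundamentalGroup M x)] (α : π_ 2 M x) :
    ∃ (M' : Type u) (_ : TopologicalSpace M') (_ : T2Space M') (_ : SecondCountableTopology M')
      (_ : ConnectedSpace M') (_ : ChartedSpace (EuclideanSpace ℝ (Fin 4)) M')
      (_ : IsManifold (𝓡 4) ∞ M') (p' : C(M', M)) (h' : C(Sphere2, M'))
      (hx : p' (h' northPole) = x),
      -- `p'` is a finite smooth covering
      IsCoveringMap p' ∧ Function.Surjective p' ∧ (∀ y : M, (p' ⁻¹' {y}).Finite) ∧
      IsLocalDiffeomorph (𝓡 4) (𝓡 4) ∞ p' ∧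
      -- `h'` is an immersion whose class is mapped to `α`
      Manifold.IsImmersion (𝓡 2) (𝓡 4) ∞ h' ∧
      inducedPi p' hx (sphereClass h') = α ∧
      -- the inclusion of the image of `h'` is trivial on fundamental groups
      ∀ z : Set.range h', FundamentalGroup.map (inclusionMap (Set.range h')) z = 1 := by
  obtain ⟨g, rfl⟩ := Quotient.exists_rep α
  obtain ⟨h, hN, hg, him⟩ := exists_sphere_immersion g
  have : LocallyPathConnectedSpace M :=
    ChartedSpace.locallyPathConnectedSpace (EuclideanSpace ℝ (Fin 4)) M
  have : PathConnectedSpace M := pathConnectedSpace_iff_connectedSpace.2 inferInstance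
  obtain ⟨S⟩ := FlatPaths.nonempty x
    (exists_isSimplyConnected_nhd (E := EuclideanSpace ℝ (Fin 4)))
  obtain ⟨Q, _, _, _, _, φ, h', hφ, hh', htriv⟩ := S.exists_lift_fundamentalGroup_map_eq_one h
  have hcov := S.isCoveringMap_proj φ
  have hp := hcov.isLocalHomeomorph
  let _ := hp.pullbackChartedSpace (H := EuclideanSpace ℝ (Fin 4))
  have := S.pathConnectedSpace_cover φ hφ
  refine ⟨S.Cover φ, inferInstance, S.t2Space_cover φ, S.secondCountableTopology_cover φ,
    inferInstance, inferInstance, hp.pullback_isManifold, S.proj φ, h', (hh' _).trans hN, hcov,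
    S.surjective_proj φ, S.finite_fiber φ, hp.isLocalDiffeomorph_pullback, ?_, ?_, htriv⟩
  · exact Manifold.IsImmersionOfComplement.isImmersion (F := EuclideanSpace ℝ (Fin 2))
      fun s => IsImmersionAtOfComplement_lift hp h'.continuous hh' s (him s)
  · refine Quotient.sound ?_
    have hcomp : ((S.proj φ).comp h').comp collapse = h.comp collapse :=
      ContinuousMap.ext fun t => hh' _
    change (((S.proj φ).comp h').comp collapse).HomotopicRel g.1 _
    rw [hcomp]
    exact hg
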